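/- **Setting.** Let $\mathbb X=(X,\tau,\mathsf d,\mathfrak m)$ be an extended metric-topological measure space: $(X,\tau)$ is a Hausdorff topological space; $\mathsf d\colon X\times X\to[0,+\infty]$ is an extended distance (symmetric, satisfying the triangle inequality, vanishing exactly on the diagonal); writing $\mathrm{Lip}_b(X,\tau,\mathsf d)$ for the algebra of bounded $\tau$-continuous $\mathsf d$-Lipschitz functions $f\colon X\to\mathbb R$, the topology $\tau$ is the initial topology of $\mathrm{Lip}_b(X,\tau,\mathsf d)$ and $\mathsf d(x,y)=\sup\{|f(x)-f(y)| : f\in\mathrm{Lip}_b(X,\tau,\mathsf d),\ \mathrm{Lip}(f,\mathsf d)\le 1\}$ for all $x,y\in X$; and $\mathfrak m$ is a finite Radon measure on $(X,\tau)$. For $A\subseteq X$ let $\mathrm{Lip}(f,A,\mathsf d)=\sup\{|f(x)-f(y)|/\mathsf d(x,y): x,y\in A,\ x\ne y\}$, $\mathrm{Lip}(f,\mathsf d)=\mathrm{Lip}(f,X,\mathsf d)$, and let $\mathrm{lip}_{\mathsf d}(f)(x)=\inf\{\mathrm{Lip}(f,U,\mathsf d): x\in U\in\tau\}$. *Arcs.*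 On the space $C([0,1];(X,\tau))$ with the compact-open topology, put $\gamma\sim\sigma$ if $\gamma\circ\varphi=\sigma\circ\psi$ for some continuous non-decreasing surjections $\varphi,\psi\colon[0,1]\to[0,1]$. Let $\mathrm{RA}(X,\mathsf d)$ be the set of classes $[\gamma]$ of $\mathsf d$-continuous curves $\gamma$ of finite $\mathsf d$-length $\ell(\gamma)$, with the topology induced by the quotient topology on $C([0,1];(X,\tau))/\!\sim$. Each $\gamma\in\mathrm{RA}(X,\mathsf d)$ has a well-defined length $\ell(\gamma)$ and constant-speed (arc-length) parameterisation $R_\gamma\colon[0,1]\to X$; put $\hat{\mathsf e}_t(\gamma)=\hat{\mathsf e}(\gamma,t)=R_\gamma(t)$, $\int_\gamma f=\ell(\gamma)\int_0^1 f(R_\gamma(t))\,\mathrm dt$ and, for $f\in\mathrm{Lip}_b(X,\tau,\mathsf d)$, $$\mathrm D_f(\gamma,t)=\limsup_{h\to0}\frac{f(R_\gamma(t+h))-f(R_\gamma(t))}{h},$$ where $h\neq 0$ is such that $t+h\in[0,1]$. *Test plans.* Let $q\in(1,\infty)$. A $\mathcal T_q$-test plan is a finite Radon measure $\pi$ on $\mathrm{RA}(X,\mathsf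 d)$ with $\int\ell\,\mathrm d\pi<+\infty$ such that its barycenter $\mu_\pi$, i.e. the unique finite Radon measure on $X$ with $\int f\,\mathrm d\mu_\pi=\int\big(\int_\gamma f\big)\,\mathrm d\pi(\gamma)$ for every bounded Borel $f$, and both marginals $(\hat{\mathsf e}_0)_\#\pi$, $(\hat{\mathsf e}_1)_\#\pi$ are absolutely continuous with respect to $\mathfrak m$ with densities in $L^q(\mathfrak m)$. Put $h_\pi=\mathrm d\mu_\pi/\mathrm d\mathfrak m$ and $\hat\pi=\pi\otimes\mathscr L^1|_{[0,1]}$. *Derivations.* A Lipschitz derivation is a linear map $b\colon\mathrm{Lip}_b(X,\tau,\mathsf d)\to L^0(\mathfrak m)$ with $b(fg)=f\,b(g)+g\,b(f)$. It has divergence $\mathrm{div}(b)\in L^1(\mathfrak m)$ if $b(f)\in L^1(\mathfrak m)$ and $\int b(f)\,\mathrm d\mathfrak m=-\int f\,\mathrm{div}(b)\,\mathrm d\mathfrak m$ for all $f\in\mathrm{Lip}_b(X,\tau,\mathsf d)$. Call $g\in L^0(\mathfrak m)$, $g\ge0$, a bound of $b$ if $|b(f)|\le g\,\mathrm{lip}_{\mathsf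 d}(f)$ $\mathfrak m$-a.e. for all $f\in\mathrm{Lip}_b(X,\tau,\mathsf d)$. Then $b$ belongs to $\mathrm{Der}^q_q(\mathbb X)$ if it has a bound in $L^q(\mathfrak m)$ and a divergence in $L^q(\mathfrak m)$; in this case $|b|$ denotes the infimum in $L^0(\mathfrak m)$ of all bounds of $b$. **Proposition.** Let $\mathbb X=(X,\tau,\mathsf d,\mathfrak m)$ be an extended metric-topological measure space, $q\in(1,\infty)$, and let $\pi$ be a $\mathcal T_q$-test plan on $\mathbb X$. Then $\hat{\mathsf e}$ and every $\mathrm D_f$ agree $\hat\pi$-a.e. with Borel maps, and for every $f\in\mathrm{Lip}_b(X,\tau,\mathsf d)$ $$\hat{\mathsf e}_\#(\mathrm D_f^+\hat\pi),\ \hat{\mathsf e}_\#(\mathrm D_f^-\hat\pi)\ll\mathfrak m,\qquad b_\pi(f):=\frac{\mathrm d\hat{\mathsf e}_\#(\mathrm D_f^+\hat\pi)}{\mathrm d\mathfrak m}-\frac{\mathrm d\hat{\mathsf e}_\#(\mathrm D_f^-\hat\pi)}{\mathrm d\mathfrak m}\in L^q(\mathfrak m),$$ where $\mathrm D_f^+$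 and $\mathrm D_f^-$ are the positive and negative parts of $\mathrm D_f$. Moreover, $b_\pi$ belongs to $\mathrm{Der}^q_q(\mathbb X)$, and $$|b_\pi|\le h_\pi,\qquad \mathrm{div}(b_\pi)=\frac{\mathrm d(\hat{\mathsf e}_0)_\#\pi}{\mathrm d\mathfrak m}-\frac{\mathrm d(\hat{\mathsf e}_1)_\#\pi}{\mathrm d\mathfrak m}.$$ -/

import Mathlib

open MeasureTheory Filter Topology Set
open scoped ENNReal NNReal unitInterval BoundedContinuousFunction

noncomputable section

namespace EMTM

/-- An extended distance on `X`: symmetric, with values in `[0, ∞]`, satisfying the triangle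
inequality and vanishing exactly on the diagonal. -/
structure ExtDist (X : Type*) where
  /-- the distance function -/
  dist : X → X → ℝ≥0∞
  dist_self : ∀ x, dist x x = 0
  dist_comm : ∀ x y, dist x y = dist y x
  dist_triangle : ∀ x y z, dist x z ≤ dist x y + dist y z
  eq_of_dist_eq_zero : ∀ x y, dist x y = 0 → x = y

/-- A copy of the set `X`, carrying the extended metric `d`. (The type `X` itself will carry the
topology `τ`, which is in general not the one induced by `d`.) -/
def ExtDist.Space {X : Type*} (_ : ExtDist X) : Type _ := X

/-- The identity map `X → (X, d)`. -/
def ExtDist.toSpace {X : Type*} (d : ExtDist X) : X → d.Space := fun x => x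

/-- The identity map `(X, d) → X`. -/
def ExtDist.ofSpace {X : Type*} (d : ExtDist X) : d.Space → X := fun x => x

instance {X : Type*} (d : ExtDist X) : EMetricSpace d.Space where
  edist x y := d.dist (d.ofSpace x) (d.ofSpace y)
  edist_self _ := d.dist_self _
  edist_comm _ _ := d.dist_comm _ _
  edist_triangle _ _ _ := d.dist_triangle _ _ _
  eq_of_edist_eq_zero h := d.eq_of_dist_eq_zero _ _ h

/-! ### Lipschitz functions -/

section Lipschitz

variable {X : Type*}

/-- `Lip(f, A, d)`, the supremum of `|f x - f y| / d(x, y)` over distinct `x, y ∈ A`. -/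
def lipConst (d : ExtDist X) (f : X → ℝ) (A : Set X) : ℝ≥0∞ :=
  ⨆ (x ∈ A) (y ∈ A) (_ : x ≠ y), edist (f x) (f y) / d.dist x y

variable [TopologicalSpace X]

theorem lipschitz_mul (d : ExtDist X) {f g : X →ᵇ ℝ}
    (hf : ∃ K : ℝ≥0, LipschitzWith K (f ∘ d.ofSpace))
    (hg : ∃ K : ℝ≥0, LipschitzWith K (g ∘ d.ofSpace)) :
    ∃ K : ℝ≥0, LipschitzWith K ((f * g : X →ᵇ ℝ) ∘ d.ofSpace) := by
  obtain ⟨K, hK⟩ := hf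
  obtain ⟨L, hL⟩ := hg
  refine ⟨‖f‖₊ * L + ‖g‖₊ * K, fun x y => ?_⟩
  have h1 : ∀ a b c e : ℝ, edist (a * b) (c * e) ≤ ‖a‖ₑ * edist b e + ‖e‖ₑ * edist a c := by
    intro a b c e
    have hs : a * b - c * e = a * (b - e) + e * (a - c) := by ring
    rw [edist_eq_enorm_sub, edist_eq_enorm_sub, edist_eq_enorm_sub, hs, ← enorm_mul, ← enorm_mul]
    exact enorm_add_le _ _
  have hfx : ∀ (h : X →ᵇ ℝ) (z : X), ‖h z‖ₑ ≤ (‖h‖₊ : ℝ≥0∞) := fun h z => by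
    rw [enorm_eq_nnnorm]
    exact_mod_cast h.norm_coe_le_norm z
  refine (h1 _ _ _ _).trans ?_
  push_cast
  rw [add_mul, mul_assoc, mul_assoc]
  exact add_le_add (mul_le_mul' (hfx f _) (hL x y)) (mul_le_mul' (hfx g _) (hK x y))

/-- `Lip_b(X, τ, d)`: the algebra of bounded `τ`-continuous `d`-Lipschitz functions `X → ℝ`. -/
def LipB (d : ExtDist X) : Subalgebra ℝ (X →ᵇ ℝ) where
  carrier := {f | ∃ K : ℝ≥0, LipschitzWith K (f ∘ d.ofSpace)}
  mul_mem' hf hg := lipschitz_mul d hf hg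
  add_mem' := by
    rintro f g ⟨K, hK⟩ ⟨L, hL⟩
    exact ⟨K + L, hK.add hL⟩
  algebraMap_mem' r := ⟨0, LipschitzWith.const r⟩

/-- The asymptotic slope `lip_d(f)(x) = inf {Lip(f, U, d) : U open neighbourhood of x}`. -/
def asympSlope (d : ExtDist X) (f : X → ℝ) (x : X) : ℝ≥0∞ :=
  ⨅ (U : Set X) (_ : IsOpen U) (_ : x ∈ U), lipConst d f U

/-- The Hausdorff topological space `(X, τ)` with the extended distance `d` is an extended
metric-topological space. -/
structure IsEMTSpace (d : ExtDist X) : Prop where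
  t2 : T2Space X
  /-- `τ` is the initial topology of `Lip_b(X, τ, d)` -/
  topology_eq : (inferInstance : TopologicalSpace X) =
    ⨅ f : LipB d, TopologicalSpace.induced (f : X →ᵇ ℝ) inferInstance
  /-- `d` is recovered from the functions in `Lip_b(X, τ, d)` with Lipschitz constant at most 1 -/
  dist_eq : ∀ x y, d.dist x y =
    ⨆ (f : LipB d) (_ : lipConst d (f : X →ᵇ ℝ) univ ≤ 1),
      edist ((f : X →ᵇ ℝ) x) ((f : X →ᵇ ℝ) y)

end Lipschitz

/-! ### Rectifiable arcs -/

section Arcs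

variable {X : Type*} [TopologicalSpace X]

/-- Two `τ`-continuous curves `γ, η` are related if `γ ∘ φ = σ ∘ ψ` for some continuous,
non-decreasing, surjective `φ, ψ : [0,1] → [0,1]`. -/
def CurveRel (γ η : C(I, X)) : Prop :=
  ∃ φ ψ : C(I, I), Monotone φ ∧ Function.Surjective φ ∧ Monotone ψ ∧ Function.Surjective ψ ∧
    γ.comp φ = η.comp ψ

variable (X) in
/-- The space `A(X, τ)` of arcs: the quotient of `C([0,1]; (X, τ))` (with the compact-open
topology) by the equivalence relation `CurveRel`, with the quotient topology. -/
def Arc : Type _ := Quot (CurveRel (X := X))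

instance : TopologicalSpace (Arc X) :=
  inferInstanceAs (TopologicalSpace (Quot (CurveRel (X := X))))

/-- The arc `[γ]` of a curve. -/
def Arc.mk (γ : C(I, X)) : Arc X := Quot.mk _ γ

/-- The `d`-variation `V_γ(t)` of `γ` on `[0, t]`. -/
def variation (d : ExtDist X) (γ : C(I, X)) (t : I) : ℝ≥0∞ :=
  eVariationOn (d.toSpace ∘ γ) (Iic t)

/-- The `d`-length of a curve. -/
def length (d : ExtDist X) (γ : C(I, X)) : ℝ≥0∞ := variation d γ 1

/-- `γ ∈ BVC([0,1]; (X, d))`: the curve is `d`-continuous and has finite `d`-length. -/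
def IsBVC (d : ExtDist X) (γ : C(I, X)) : Prop :=
  Continuous (d.toSpace ∘ γ) ∧ length d γ < ∞

/-- The space `RA(X, d)` of rectifiable arcs, with the subspace topology inherited from
`A(X, τ)`. -/
def RectArc (d : ExtDist X) : Type _ := {a : Arc X // ∃ γ, IsBVC d γ ∧ Arc.mk γ = a}

instance (d : ExtDist X) : TopologicalSpace (RectArc d) :=
  inferInstanceAs (TopologicalSpace {a : Arc X // ∃ γ, IsBVC d γ ∧ Arc.mk γ = a})

instance (d : ExtDist X) : MeasurableSpace (RectArc d) := borel _

instance (d : ExtDist X) : BorelSpace (RectArc d) := ⟨rfl⟩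

/-- `R` is the arc-length parameterisation of `γ`: it is an `ℓ(γ)`-Lipschitz curve in
`BVC([0,1]; (X, d))`, has constant `d`-speed, and `γ(t) = R(ℓ(γ)⁻¹ V_γ(t))` for all `t`, with
`ℓ(γ)⁻¹ V_γ(t) = 0` if `ℓ(γ) = 0`. -/
structure IsArcLengthParam (d : ExtDist X) (γ R : C(I, X)) : Prop where
  isBVC : IsBVC d R
  lipschitz : ∀ s t : I, d.dist (R s) (R t) ≤ length d γ * edist s t
  const_speed : ∀ t : I, variation d R t = length d R * ENNReal.ofReal t
  reparam : ∀ t : I,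
    γ t = R (projIcc (0 : ℝ) 1 zero_le_one (variation d γ t / length d γ).toReal)

open Classical in
/-- The arc-length parameterisation `R_γ` of `γ ∈ BVC([0,1]; (X, d))`, which exists and is unique
whenever `d` makes `X` an extended metric-topological space. -/
def arcLengthParam (d : ExtDist X) (γ : C(I, X)) : C(I, X) :=
  if h : ∃ R, IsArcLengthParam d γ R then h.choose else γ

variable {d : ExtDist X}

/-- A representative in `BVC([0,1]; (X, d))` of a rectifiable arc. -/
def RectArc.curve (a : RectArc d) : C(I, X) := a.2.choose

/-- The length `ℓ` of a rectifiable arc (independent of the representative). -/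
def RectArc.len (a : RectArc d) : ℝ≥0∞ := length d a.curve

/-- The arc-length parameterisation of a rectifiable arc (independent of the representative). -/
def RectArc.param (a : RectArc d) : C(I, X) := arcLengthParam d a.curve

/-- The path integral `∫_γ f = ℓ(γ) ∫₀¹ f(R_γ(t)) dt`. -/
def RectArc.pathIntegral (a : RectArc d) (f : X → ℝ) : ℝ :=
  a.len.toReal * ∫ t : I, f (a.param t)

/-- The arc-length evaluation map at time `t`. -/
def evalAt (d : ExtDist X) (t : I) (a : RectArc d) : X := a.param t

/-- The arc-length evaluation map on `RA(X, d) × [0,1]`. -/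
def evalMap (d : ExtDist X) (p : RectArc d × I) : X := p.1.param p.2

/-- `D_f(γ, t)`, the upper limit as `s → t` (`s ∈ [0,1]`, `s ≠ t`) of the difference quotients
of `f ∘ R_γ` at `t`. -/
def arcDeriv (d : ExtDist X) (f : X → ℝ) (p : RectArc d × I) : ℝ :=
  limsup (fun s : I => (f (p.1.param s) - f (p.1.param p.2)) / ((s : ℝ) - (p.2 : ℝ))) (𝓝[≠] p.2)

end Arcs

/-! ### Test plans -/

section Plans

variable {X : Type*} [TopologicalSpace X] [MeasurableSpace X]

/-- `μ` is the barycenter of `π`: the (necessarily unique) finite Radon measure on `X` such that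
`∫ f dμ = ∫ (∫_γ f) dπ(γ)` for every bounded Borel function `f`. -/
structure IsBarycenter (d : ExtDist X) (π : Measure (RectArc d)) (μ : Measure X) : Prop where
  finite : IsFiniteMeasure μ
  radon : μ.InnerRegular
  integral_eq : ∀ f : X → ℝ, Measurable f → (∃ C, ∀ x, |f x| ≤ C) →
    ∫ x, f x ∂μ = ∫ a, a.pathIntegral f ∂π

/-- The real-valued density of a finite measure with respect to `m`. -/
def density (μ m : Measure X) (x : X) : ℝ := (μ.rnDeriv m x).toReal

/-- A dynamic plan: a finite Radon measure on `RA(X, d)` with finite integral of the length. -/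
structure IsDynamicPlan (d : ExtDist X) (π : Measure (RectArc d)) : Prop where
  finite : IsFiniteMeasure π
  radon : π.InnerRegular
  lintegral_len : ∫⁻ a, a.len ∂π < ∞

/-- A `𝒯_q`-test plan: a dynamic plan whose barycenter and whose initial and final marginals are
absolutely continuous with respect to `m`, with densities in `L^q(m)`. -/
structure IsTestPlan (d : ExtDist X) (m : Measure X) (q : ℝ≥0∞) (π : Measure (RectArc d)) : Prop
    extends IsDynamicPlan d π where
  barycenter : ∃ μ, IsBarycenter d π μ ∧ μ ≪ m ∧ MemLp (density μ m) q m
  initial_ac : π.map (evalAt d 0) ≪ m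
  initial_memLp : MemLp (density (π.map (evalAt d 0)) m) q m
  final_ac : π.map (evalAt d 1) ≪ m
  final_memLp : MemLp (density (π.map (evalAt d 1)) m) q m

/-- The product `π̂` of `π` and the Lebesgue measure on `[0,1]`. -/
def planHat {d : ExtDist X} (π : Measure (RectArc d)) : Measure (RectArc d × I) :=
  π.prod volume

/-- The push-forward under the arc-length evaluation map of `D_f⁺ π̂`. -/
def pushPos (d : ExtDist X) (π : Measure (RectArc d)) (f : X → ℝ) : Measure X :=
  ((planHat π).withDensity fun p => ENNReal.ofReal (arcDeriv d f p)).map (evalMap d)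

/-- The push-forward under the arc-length evaluation map of `D_f⁻ π̂`. -/
def pushNeg (d : ExtDist X) (π : Measure (RectArc d)) (f : X → ℝ) : Measure X :=
  ((planHat π).withDensity fun p => ENNReal.ofReal (-arcDeriv d f p)).map (evalMap d)

/-- `b_π(f)`, as the difference of the densities of `ê_#(D_f⁺ π̂)` and `ê_#(D_f⁻ π̂)`. -/
def planDer (d : ExtDist X) (m : Measure X) (π : Measure (RectArc d)) (f : X → ℝ) (x : X) : ℝ :=
  density (pushPos d π f) m x - density (pushNeg d π f) m x

end Plans

/-! ### Derivations -/

section Derivations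

variable {X : Type*} [TopologicalSpace X] [MeasurableSpace X] [BorelSpace X]

/-- The class in `L⁰(m)` of a function in `Lip_b(X, τ, d)`. -/
def toL0 {d : ExtDist X} (m : Measure X) (f : LipB d) : X →ₘ[m] ℝ :=
  AEEqFun.mk (f : X →ᵇ ℝ) (f : X →ᵇ ℝ).continuous.aestronglyMeasurable

/-- Lipschitz derivations: linear maps `Lip_b(X, τ, d) → L⁰(m)` satisfying the Leibniz rule. -/
structure LipDerivation (d : ExtDist X) (m : Measure X) extends LipB d →ₗ[ℝ] (X →ₘ[m] ℝ) where
  leibniz : ∀ f g : LipB d, toFun (f * g) = toL0 m f * toFun g + toL0 m g * toFun f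

variable {d : ExtDist X} {m : Measure X}

/-- The functions `g ∈ L⁰(m)⁺` with `|b(f)| ≤ g lip_d(f)` `m`-a.e. for all `f`. -/
def LipDerivation.bounds (b : LipDerivation d m) : Set (X →ₘ[m] ℝ) :=
  {g | 0 ≤ g ∧ ∀ f : LipB d,
    ∀ᵐ x ∂m, |b.toFun f x| ≤ g x * (asympSlope d (f : X →ᵇ ℝ) x).toReal}

/-- `v` is the divergence of `b` (in particular, `b` has divergence). -/
structure LipDerivation.IsDivergence (b : LipDerivation d m) (v : X → ℝ) : Prop where
  integrable : ∀ f : LipB d, Integrable (b.toFun f) m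
  integrable_div : Integrable v m
  integral_eq : ∀ f : LipB d, ∫ x, b.toFun f x ∂m = -∫ x, (f : X →ᵇ ℝ) x * v x ∂m

/-- `b ∈ Der^q_r(X)`: `b` is a Di Marino derivation which admits a bound in `L^q(m)⁺` and has a
divergence in `L^r(m)`. -/
def LipDerivation.MemDer (b : LipDerivation d m) (q r : ℝ≥0∞) : Prop :=
  (∃ g ∈ b.bounds, MemLp g q m) ∧ ∃ v, b.IsDivergence v ∧ MemLp v r m

/-- `g = |b|`: `g` is the infimum in `L⁰(m)` of all the bounds of `b`. -/
def LipDerivation.IsPointwiseNorm (b : LipDerivation d m) (g : X →ₘ[m] ℝ) : Prop :=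
  IsGLB b.bounds g

end Derivations

end EMTM

end

/-!
The argument rests on one formula: for every bounded Borel function `φ`,
`∫ φ b_π(f) dm = ∫ φ(ê) D_f dπ̂` (`integral_signedDensity_mul`). Since `f ∘ R_γ` is Lipschitz,
it is differentiable at almost every time, so `D_f` is linear in `f` and satisfies the Leibniz rule
`π̂`-a.e.; testing against indicator functions transfers both to `b_π`
(`IsDynamicPlan.planDer_eq_of_arcDeriv_eq`). The fundamental theorem of calculus along each arc
(`IsEMTSpace.integral_arcDeriv`) gives the divergence. As `R_γ` is `τ`-continuous and
`ℓ(γ)`-Lipschitz, `|D_f| ≤ ℓ · lip_d(f)(ê)` everywhere (`IsEMTSpace.abs_arcDeriv_le`), and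
`ê_#(ℓ π̂)` is the barycenter (`IsBarycenter.eq_arcLengthMeasure`); hence the absolute continuity of
`ê_#(D_f^± π̂)` and the bound `|b_π(f)| ≤ h_π lip_d(f)` (`abs_signedDensity_le`). The bounds of a
derivation are stable under binary infima, so that minimising the integral produces `|b_π|`
(`exists_isGLB_of_inf_mem`).

What needs care is measurability, since neither `X` nor `RA(X, d)` is assumed to be metrisable, and
the Borel sets of `X` may not be generated by continuous functions. The evaluation map is
therefore shown to be continuous on large sets. The arcs whose parameterisation meets a given open
set, with prescribed strict lower bounds for the lengths before and after the visit, form an open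
set (`IsEMTSpace.isOpen_visit`); when the total length is continuous on a set `A`, two lower bounds
pin down the time of the visit, which makes `ê` jointly continuous on `A × [0, 1]`
(`IsEMTSpace.continuousOn_evalMap`). The length is a supremum of continuous functionals
(`IsEMTSpace.isLUB_incrementSup`), so inner regularity of `π` and Egorov's theorem provide such sets
`A` of almost full measure (`exists_continuousOn_compl_of_isLUB`). The Hausdorff property of
`RA(X, d)` is never needed.
-/

namespace EMTM

/-! ### Variation and arc-length parameterisation of curves -/

section Curves

variable {X : Type*} [TopologicalSpace X] {d : ExtDist X}

/-- Since `τ` is the initial topology of `Lip_b(X, τ, d)`, convergence in `X` may be tested on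
the functions of this algebra. -/
theorem IsEMTSpace.tendsto_iff (hd : IsEMTSpace d) {ι : Type*} {l : Filter ι} {u : ι → X} {x : X} :
    Tendsto u l (𝓝 x) ↔ ∀ f : LipB d, Tendsto (fun i => (f : X →ᵇ ℝ) (u i)) l
      (𝓝 ((f : X →ᵇ ℝ) x)) := by
  have h : 𝓝 x = ⨅ f : LipB d, comap (f : X →ᵇ ℝ) (𝓝 ((f : X →ᵇ ℝ) x)) := by
    have h1 : 𝓝 x = @nhds X (⨅ f : LipB d,
        TopologicalSpace.induced (f : X →ᵇ ℝ) inferInstance) x := by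
      rw [← hd.topology_eq]
    rw [h1, nhds_iInf]
    simp only [nhds_induced]
  rw [h, tendsto_iInf]
  simp only [tendsto_comap_iff, Function.comp_def]

theorem LipB.continuous_comp (f : LipB d) {T : Type*} [TopologicalSpace T] {c : T → X}
    (hc : Continuous (d.toSpace ∘ c)) : Continuous (fun t => (f : X →ᵇ ℝ) (c t)) := by
  obtain ⟨K, hK⟩ := f.2
  exact hK.continuous.comp hc

/-- The topology induced by `d` is finer than `τ`. -/
theorem IsEMTSpace.continuous_of_toSpace (hd : IsEMTSpace d) {T : Type*} [TopologicalSpace T]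
    {c : T → X} (hc : Continuous (d.toSpace ∘ c)) : Continuous c :=
  continuous_iff_continuousAt.2 fun _ =>
    hd.tendsto_iff.2 fun f => (LipB.continuous_comp f hc).continuousAt

theorem variation_le_length (γ : C(I, X)) (t : I) : variation d γ t ≤ length d γ :=
  eVariationOn.mono _ (Iic_subset_Iic.2 t.2.2)

theorem Iic_one_eq : (Iic 1 : Set I) = univ := eq_univ_of_forall fun t => t.2.2

theorem variation_zero (γ : C(I, X)) : variation d γ 0 = 0 := by
  refine eVariationOn.subsingleton _ fun x hx y hy => ?_
  exact (le_antisymm (mem_Iic.1 hx) x.2.1).trans (le_antisymm (mem_Iic.1 hy) y.2.1).symm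

theorem variation_mono (γ : C(I, X)) : Monotone (variation d γ) := fun _ _ h =>
  eVariationOn.mono _ (Iic_subset_Iic.2 h)

theorem variation_add_Icc (γ : C(I, X)) {s t : I} (h : s ≤ t) :
    variation d γ s + eVariationOn (d.toSpace ∘ γ) (Icc s t) = variation d γ t := by
  unfold variation
  rw [← Iic_union_Icc_eq_Iic h,
    eVariationOn.union _ (isGreatest_Iic) (isLeast_Icc h)]

theorem variation_add_Ici (γ : C(I, X)) (t : I) :
    variation d γ t + eVariationOn (d.toSpace ∘ γ) (Ici t) = length d γ := by
  unfold length variation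
  rw [Iic_one_eq, ← Iic_union_Ici (a := t),
    eVariationOn.union _ (isGreatest_Iic) (isLeast_Ici)]

theorem dist_add_variation_le (γ : C(I, X)) {s t : I} (h : s ≤ t) :
    d.dist (γ s) (γ t) + variation d γ s ≤ variation d γ t := by
  rw [← variation_add_Icc γ h, add_comm]
  gcongr
  exact eVariationOn.edist_le (d.toSpace ∘ γ) (left_mem_Icc.2 h) (right_mem_Icc.2 h)

theorem IsBVC.variation_ne_top {γ : C(I, X)} (hγ : IsBVC d γ) (t : I) : variation d γ t ≠ ∞ :=
  ((variation_le_length γ t).trans_lt hγ.2).ne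

theorem IsBVC.boundedVariationOn {γ : C(I, X)} (hγ : IsBVC d γ) :
    BoundedVariationOn (d.toSpace ∘ γ) univ := by
  have := hγ.2.ne
  rwa [length, variation, Iic_one_eq] at this

/-- The variation of a continuous curve of finite length depends continuously on the endpoint. -/
theorem IsBVC.continuous_variation {γ : C(I, X)} (hγ : IsBVC d γ) :
    Continuous (variation d γ) := by
  refine continuous_iff_continuousAt.2 fun t => ?_
  have hl := hγ.boundedVariationOn.tendsto_eVariationOn_Icc_zero_left (x := t)
    hγ.1.continuousAt.continuousWithinAt
  have hr := hγ.boundedVariationOn.tendsto_eVariationOn_Icc_zero_right t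
    hγ.1.continuousAt.continuousWithinAt
  simp only [univ_inter, nhdsWithin_univ] at hl hr
  have hlow := ENNReal.Tendsto.sub (tendsto_const_nhds (x := variation d γ t)) hl
    (Or.inl (hγ.variation_ne_top t))
  have hup := (tendsto_const_nhds (x := variation d γ t)).add hr
  rw [tsub_zero] at hlow
  rw [add_zero] at hup
  refine tendsto_of_tendsto_of_tendsto_of_le_of_le hlow hup (fun s => ?_) (fun s => ?_)
  · rcases le_total s t with h | h
    · exact tsub_le_iff_right.2 (variation_add_Icc γ h).ge
    · exact tsub_le_self.trans (variation_mono γ h)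
  · rcases le_total s t with h | h
    · exact (variation_mono γ h).trans le_self_add
    · exact (variation_add_Icc γ h).ge

/-- The normalised arc-length function of a curve of finite length, as a self-map of `[0, 1]`. -/
noncomputable def IsBVC.arcLength {γ : C(I, X)} (hγ : IsBVC d γ) : C(I, I) where
  toFun t := projIcc (0 : ℝ) 1 zero_le_one (variation d γ t / length d γ).toReal
  continuous_toFun := by
    refine continuous_projIcc.comp ?_
    by_cases h0 : length d γ = 0
    · have : ∀ t, variation d γ t = 0 := fun t => le_antisymm
        ((variation_le_length γ t).trans h0.le) bot_le
      simp only [this, ENNReal.zero_div]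
      exact continuous_const
    · simp only [ENNReal.toReal_div]
      exact (ENNReal.continuousOn_toReal.comp_continuous hγ.continuous_variation
        hγ.variation_ne_top).div_const _

theorem IsBVC.length_mul_arcLength {γ : C(I, X)} (hγ : IsBVC d γ) (t : I) :
    length d γ * ENNReal.ofReal (hγ.arcLength t) = variation d γ t := by
  by_cases h0 : length d γ = 0
  · rw [h0, zero_mul]
    exact (le_antisymm ((variation_le_length γ t).trans h0.le) bot_le).symm
  have hle : variation d γ t / length d γ ≤ 1 :=
    ENNReal.div_le_of_le_mul (by rw [one_mul]; exact variation_le_length γ t)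
  have hmem : (variation d γ t / length d γ).toReal ∈ Icc (0 : ℝ) 1 :=
    ⟨ENNReal.toReal_nonneg, ENNReal.toReal_le_of_le_ofReal zero_le_one (by simpa using hle)⟩
  have : (hγ.arcLength t : ℝ) = (variation d γ t / length d γ).toReal := by
    change ((projIcc (0 : ℝ) 1 zero_le_one (variation d γ t / length d γ).toReal : I) : ℝ) = _
    rw [projIcc_of_mem _ hmem]
  rw [this, ENNReal.ofReal_toReal (hle.trans_lt ENNReal.one_lt_top).ne]
  exact ENNReal.mul_div_cancel h0 hγ.2.ne

theorem IsBVC.arcLength_mono {γ : C(I, X)} (hγ : IsBVC d γ) : Monotone hγ.arcLength := by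
  intro s t h
  refine monotone_projIcc zero_le_one (ENNReal.toReal_mono ?_ ?_)
  · by_cases h0 : length d γ = 0
    · have : variation d γ t = 0 := le_antisymm ((variation_le_length γ t).trans h0.le) bot_le
      simp [this]
    · exact ENNReal.div_ne_top (hγ.variation_ne_top t) h0
  · exact ENNReal.div_le_div_right (variation_mono γ h) _

theorem IsBVC.arcLength_surjective {γ : C(I, X)} (hγ : IsBVC d γ) (h0 : length d γ ≠ 0) :
    Function.Surjective hγ.arcLength := by
  have hz : hγ.arcLength 0 = 0 := by
    change projIcc (0 : ℝ) 1 zero_le_one (variation d γ 0 / length d γ).toReal = 0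
    rw [variation_zero]
    simp
  have ho : hγ.arcLength 1 = 1 := by
    change projIcc (0 : ℝ) 1 zero_le_one (length d γ / length d γ).toReal = 1
    rw [ENNReal.div_self h0 hγ.2.ne]
    simp
  intro y
  have := intermediate_value_Icc (zero_le_one (α := I)) hγ.arcLength.continuous.continuousOn
  rw [hz, ho] at this
  obtain ⟨x, -, hx⟩ := this ⟨y.2.1, y.2.2⟩
  exact ⟨x, hx⟩

/-- A curve factors through its normalised arc-length function as a Lipschitz map; this is why the
composition with a right inverse does not depend on the choice of the inverse. -/
theorem IsBVC.dist_le_arcLength {γ : C(I, X)} (hγ : IsBVC d γ) (s t : I) :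
    d.dist (γ s) (γ t) ≤ length d γ * edist (hγ.arcLength s) (hγ.arcLength t) := by
  wlog h : s ≤ t generalizing s t
  · rw [d.dist_comm, edist_comm]
    exact this t s (le_of_not_ge h)
  have h1 := dist_add_variation_le (d := d) γ h
  rw [← ENNReal.le_sub_iff_add_le_right (hγ.variation_ne_top s) (variation_mono γ h),
    ← hγ.length_mul_arcLength, ← hγ.length_mul_arcLength,
    ← ENNReal.mul_sub (fun _ _ => hγ.2.ne), ← ENNReal.ofReal_sub _ (hγ.arcLength s).2.1] at h1
  refine h1.trans (mul_le_mul_right ?_ _)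
  rw [edist_comm, Subtype.edist_eq, edist_dist, Real.dist_eq]
  exact ENNReal.ofReal_le_ofReal (le_abs_self _)

/-- Reparameterising a curve by a monotone surjection does not change its variation. -/
theorem variation_comp (γ : C(I, X)) (W : C(I, I)) (hW : Monotone W)
    (hs : Function.Surjective W) (t : I) :
    variation d (γ.comp W) t = variation d γ (W t) := by
  have himg : W '' Iic t = Iic (W t) := by
    refine Subset.antisymm (image_subset_iff.2 fun s hs => hW hs) fun y hy => ?_
    obtain ⟨x, rfl⟩ := hs y
    rcases le_total x t with h | h
    · exact ⟨x, h, rfl⟩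
    · exact ⟨t, mem_Iic.2 le_rfl, le_antisymm (hW h) hy⟩
  unfold variation
  rw [← himg, ← eVariationOn.comp_eq_of_monotoneOn _ _ (hW.monotoneOn _)]
  rfl

theorem eVariationOn_Ici_comp (γ : C(I, X)) (W : C(I, I)) (hW : Monotone W)
    (hs : Function.Surjective W) (t : I) :
    eVariationOn (d.toSpace ∘ γ.comp W) (Ici t) = eVariationOn (d.toSpace ∘ γ) (Ici (W t)) := by
  have himg : W '' Ici t = Ici (W t) := by
    refine Subset.antisymm (image_subset_iff.2 fun s hs => hW hs) fun y hy => ?_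
    obtain ⟨x, rfl⟩ := hs y
    rcases le_total t x with h | h
    · exact ⟨x, h, rfl⟩
    · exact ⟨t, mem_Ici.2 le_rfl, le_antisymm hy (hW h)⟩
  rw [← himg, ← eVariationOn.comp_eq_of_monotoneOn _ _ (hW.monotoneOn _)]
  rfl

theorem map_one_of_surjective (W : C(I, I)) (hW : Monotone W) (hs : Function.Surjective W) :
    W 1 = 1 := by
  obtain ⟨x, hx⟩ := hs 1
  exact le_antisymm (W 1).2.2 (hx.symm.le.trans (hW (show x ≤ 1 from x.2.2)))

theorem length_comp (γ : C(I, X)) (W : C(I, I)) (hW : Monotone W)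
    (hs : Function.Surjective W) : length d (γ.comp W) = length d γ := by
  unfold length
  rw [variation_comp γ W hW hs, map_one_of_surjective W hW hs]

theorem CurveRel.length_eq {γ η : C(I, X)} (h : CurveRel γ η) : length d γ = length d η := by
  obtain ⟨φ, ψ, hφ, hφs, hψ, hψs, h⟩ := h
  rw [← length_comp γ φ hφ hφs, h, length_comp η ψ hψ hψs]

theorem length_eq_of_mk_eq {γ η : C(I, X)} (h : Arc.mk γ = Arc.mk η) :
    length d γ = length d η :=
  congrArg (Quot.lift (length d) fun _ _ => CurveRel.length_eq) h

theorem apply_eq_of_length_eq_zero {γ : C(I, X)} (hγ : length d γ = 0) (s t : I) : γ s = γ t := by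
  refine d.eq_of_dist_eq_zero _ _ (le_antisymm (le_trans ?_ hγ.le) bot_le)
  refine eVariationOn.edist_le (d.toSpace ∘ γ) (s := Iic 1) s.2.2 t.2.2

/-- Every curve of finite length has an arc-length parameterisation, obtained by composing the
curve with a right inverse of its normalised arc-length function. -/
theorem IsEMTSpace.exists_isArcLengthParam (hd : IsEMTSpace d) {γ : C(I, X)} (hγ : IsBVC d γ) :
    ∃ R, IsArcLengthParam d γ R := by
  -- A curve of length zero is constant; its normalised arc-length function is `0`, not surjective.
  by_cases h0 : length d γ = 0
  · have hv : ∀ t, variation d γ t = 0 := fun t =>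
      le_antisymm ((variation_le_length γ t).trans h0.le) bot_le
    exact ⟨γ, hγ, fun s t => by rw [apply_eq_of_length_eq_zero h0 s t, d.dist_self]; exact bot_le,
      fun t => by rw [hv, h0, zero_mul], fun t => apply_eq_of_length_eq_zero h0 _ _⟩
  obtain ⟨g, hg⟩ := (hγ.arcLength_surjective h0).hasRightInverse
  have hlip : ∀ s t : I, d.dist (γ (g s)) (γ (g t)) ≤ length d γ * edist s t := fun s t => by
    simpa only [hg s, hg t] using hγ.dist_le_arcLength (g s) (g t)
  have hL : LipschitzWith (length d γ).toNNReal (d.toSpace ∘ γ ∘ g) := fun s t => by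
    rw [ENNReal.coe_toNNReal hγ.2.ne]
    exact hlip s t
  let R : C(I, X) := ⟨γ ∘ g, hd.continuous_of_toSpace hL.continuous⟩
  have hRW : R.comp hγ.arcLength = γ := by
    ext t
    refine d.eq_of_dist_eq_zero _ _ (le_antisymm ?_ bot_le)
    refine (hγ.dist_le_arcLength _ _).trans ?_
    rw [hg (hγ.arcLength t), edist_self, mul_zero]
  have hvar : ∀ t, variation d R t = length d γ * ENNReal.ofReal t := fun t => by
    obtain ⟨s, rfl⟩ := hγ.arcLength_surjective h0 t
    rw [← variation_comp R _ hγ.arcLength_mono (hγ.arcLength_surjective h0), hRW,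
      hγ.length_mul_arcLength]
  have hlen : length d R = length d γ := by
    simpa using! hvar 1
  refine ⟨R, ⟨hL.continuous, hlen.trans_lt hγ.2⟩, hlip, fun t => by rw [hvar, hlen], fun t => ?_⟩
  exact (DFunLike.congr_fun hRW t).symm

/-- The arc-length parameterisation represents the same arc as the curve. -/
theorem IsArcLengthParam.mk_eq {γ R : C(I, X)} (hγ : IsBVC d γ) (h : IsArcLengthParam d γ R) :
    Arc.mk R = Arc.mk γ := by
  by_cases h0 : length d γ = 0
  · congr 1
    ext t
    rw [h.reparam t]
    refine d.eq_of_dist_eq_zero _ _ (le_antisymm ((h.lipschitz _ _).trans ?_) bot_le)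
    rw [h0, zero_mul]
  · refine (Quot.sound ⟨ContinuousMap.id I, hγ.arcLength, monotone_id, Function.surjective_id,
      hγ.arcLength_mono, hγ.arcLength_surjective h0, ?_⟩).symm
    ext t
    exact h.reparam t

namespace RectArc

variable (a : RectArc d)

theorem isBVC_curve : IsBVC d a.curve := a.2.choose_spec.1

theorem mk_curve : Arc.mk a.curve = a.1 := a.2.choose_spec.2

theorem len_ne_top : a.len ≠ ∞ := a.isBVC_curve.2.ne

theorem isArcLengthParam (hd : IsEMTSpace d) : IsArcLengthParam d a.curve a.param := by
  have h := hd.exists_isArcLengthParam a.isBVC_curve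
  rw [param, arcLengthParam, dif_pos h]
  exact h.choose_spec

theorem mk_param (hd : IsEMTSpace d) : Arc.mk a.param = a.1 :=
  ((a.isArcLengthParam hd).mk_eq a.isBVC_curve).trans a.mk_curve

theorem length_param (hd : IsEMTSpace d) : length d a.param = a.len :=
  length_eq_of_mk_eq ((a.mk_param hd).trans a.mk_curve.symm)

theorem dist_param_le (hd : IsEMTSpace d) (s t : I) :
    d.dist (a.param s) (a.param t) ≤ a.len * edist s t :=
  (a.isArcLengthParam hd).lipschitz s t

theorem variation_param (hd : IsEMTSpace d) (t : I) :
    variation d a.param t = a.len * ENNReal.ofReal t := by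
  rw [(a.isArcLengthParam hd).const_speed, a.length_param hd]

theorem eVariationOn_Ici_param (hd : IsEMTSpace d) (t : I) :
    eVariationOn (d.toSpace ∘ a.param) (Ici t) = a.len * ENNReal.ofReal (1 - t) := by
  have h := variation_add_Ici (d := d) a.param t
  rw [a.variation_param hd, a.length_param hd] at h
  have h2 : a.len * ENNReal.ofReal t + a.len * ENNReal.ofReal (1 - t) = a.len := by
    rw [← mul_add, ← ENNReal.ofReal_add t.2.1 (sub_nonneg.2 t.2.2)]
    simp
  refine (ENNReal.add_right_inj ?_).1 (h.trans h2.symm)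
  exact ENNReal.mul_ne_top a.len_ne_top ENNReal.ofReal_ne_top

end RectArc

end Curves

/-! ### Semicontinuity of the length on the space of arcs -/

section Semicontinuity

theorem edist_le_dist_of_lipConst_le_one {X : Type*} {d : ExtDist X} {f : X → ℝ}
    (hf : lipConst d f univ ≤ 1) (x y : X) :
    edist (f x) (f y) ≤ d.dist x y := by
  by_cases hxy : x = y
  · simp [hxy]
  have h0 : d.dist x y ≠ 0 := fun h => hxy (d.eq_of_dist_eq_zero _ _ h)
  by_cases ht : d.dist x y = ∞
  · rw [ht]; exact le_top
  have : edist (f x) (f y) / d.dist x y ≤ 1 := by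
    refine le_trans ?_ hf
    unfold lipConst
    refine le_iSup_of_le x (le_iSup_of_le (mem_univ _) (le_iSup_of_le y
      (le_iSup_of_le (mem_univ _) (le_iSup_of_le hxy le_rfl))))
  rwa [ENNReal.div_le_iff h0 ht, one_mul] at this

variable {X : Type*} [TopologicalSpace X] {d : ExtDist X}

theorem IsEMTSpace.lowerSemicontinuous_dist (hd : IsEMTSpace d) :
    LowerSemicontinuous fun p : X × X => d.dist p.1 p.2 := by
  simp only [hd.dist_eq]
  refine lowerSemicontinuous_iSup fun f => lowerSemicontinuous_iSup fun _ => ?_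
  refine Continuous.lowerSemicontinuous ?_
  exact ((f : X →ᵇ ℝ).continuous.comp continuous_fst).edist
    ((f : X →ᵇ ℝ).continuous.comp continuous_snd)

theorem IsEMTSpace.lowerSemicontinuous_eVariationOn (hd : IsEMTSpace d) (s : Set I) :
    LowerSemicontinuous fun γ : C(I, X) => eVariationOn (d.toSpace ∘ γ) s := by
  refine lowerSemicontinuous_iSup fun p => lowerSemicontinuous_sum fun i _ => ?_
  exact hd.lowerSemicontinuous_dist.comp (g := fun γ : C(I, X) =>
    (γ (p.2.1 (i + 1)), γ (p.2.1 i)))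
    ((continuous_eval_const _).prodMk (continuous_eval_const _))

variable (d) in
/-- The curves which visit `O` at a time that leaves a variation of more than `α - ε` behind and
of more than `β - ε` ahead. -/
def visitSet (α β ε : ℝ≥0∞) (O : Set X) : Set C(I, X) :=
  {γ | ∃ p : I, α < variation d γ p + ε ∧ β < eVariationOn (d.toSpace ∘ γ) (Ici p) + ε ∧ γ p ∈ O}

theorem IsEMTSpace.isOpen_visitSet (hd : IsEMTSpace d) (α β ε : ℝ≥0∞) {O : Set X}
    (hO : IsOpen O) : IsOpen (visitSet d α β ε O) := by
  have h : visitSet d α β ε O = ⋃ p : I, {γ | α < variation d γ p + ε} ∩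
      ({γ | β < eVariationOn (d.toSpace ∘ γ) (Ici p) + ε} ∩ {γ | γ p ∈ O}) := by
    ext γ
    simp [visitSet]
  rw [h]
  refine isOpen_iUnion fun p => IsOpen.inter ?_ (IsOpen.inter ?_ ?_)
  · exact ((hd.lowerSemicontinuous_eVariationOn (Iic p)).add
      lowerSemicontinuous_const).isOpen_preimage α
  · exact ((hd.lowerSemicontinuous_eVariationOn (Ici p)).add
      lowerSemicontinuous_const).isOpen_preimage β
  · exact hO.preimage (continuous_eval_const p)

theorem mem_visitSet_comp {α β ε : ℝ≥0∞} {O : Set X} (γ : C(I, X)) (W : C(I, I))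
    (hW : Monotone W) (hs : Function.Surjective W) :
    γ.comp W ∈ visitSet d α β ε O ↔ γ ∈ visitSet d α β ε O := by
  constructor
  · rintro ⟨p, h1, h2, h3⟩
    rw [variation_comp γ W hW hs] at h1
    rw [eVariationOn_Ici_comp γ W hW hs] at h2
    exact ⟨W p, h1, h2, h3⟩
  · rintro ⟨p, h1, h2, h3⟩
    obtain ⟨p, rfl⟩ := hs p
    rw [← variation_comp γ W hW hs] at h1
    rw [← eVariationOn_Ici_comp γ W hW hs] at h2
    exact ⟨p, h1, h2, h3⟩

theorem CurveRel.mem_visitSet_iff {α β ε : ℝ≥0∞} {O : Set X} {γ η : C(I, X)}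
    (h : CurveRel γ η) : γ ∈ visitSet d α β ε O ↔ η ∈ visitSet d α β ε O := by
  obtain ⟨φ, ψ, hφ, hφs, hψ, hψs, h⟩ := h
  rw [← mem_visitSet_comp γ φ hφ hφs, h, mem_visitSet_comp η ψ hψ hψs]

theorem continuous_rectArc_val : Continuous fun a : RectArc d => a.1 := continuous_subtype_val

/-- The arcs whose arc-length parameterisation passes through the open set `O`, with prescribed
lower bounds for the lengths of the two pieces, form an open set. -/
theorem IsEMTSpace.isOpen_visit (hd : IsEMTSpace d) (α β ε : ℝ≥0∞) {O : Set X}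
    (hO : IsOpen O) : IsOpen {a : RectArc d | ∃ p : I,
      α < a.len * ENNReal.ofReal p + ε ∧ β < a.len * ENNReal.ofReal (1 - p) + ε ∧
        a.param p ∈ O} := by
  let P : Arc X → Prop := Quot.lift (fun γ => γ ∈ visitSet d α β ε O)
    fun _ _ h => propext h.mem_visitSet_iff
  have hP : IsOpen {x | P x} := by
    change IsOpen (Quot.mk _ ⁻¹' {x | P x})
    exact hd.isOpen_visitSet α β ε hO
  have h := hP.preimage (continuous_rectArc_val (d := d))
  convert h using 1
  ext a
  have : a.1 ∈ {x | P x} ↔ a.param ∈ visitSet d α β ε O := by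
    rw [← a.mk_param hd]
    rfl
  rw [mem_preimage, this]
  simp only [visitSet, mem_ofPred_eq, a.variation_param hd, a.eVariationOn_Ici_param hd]

/-- The largest sum of increments of the functions `f i` along consecutive pieces of a curve. -/
noncomputable def incrementSup (f : ℕ → LipB d) (n : ℕ) (γ : C(I, X)) : ℝ :=
  sSup ((fun u : ℕ → I => ∑ i ∈ Finset.range n,
    dist ((f i : X →ᵇ ℝ) (γ (u (i + 1)))) ((f i : X →ᵇ ℝ) (γ (u i)))) '' {u | Monotone u})

theorem isCompact_monotone_seq : IsCompact {u : ℕ → I | Monotone u} :=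
  isClosed_monotone.isCompact

theorem continuous_increments (f : ℕ → LipB d) (n : ℕ) :
    Continuous fun p : C(I, X) × (ℕ → I) => ∑ i ∈ Finset.range n,
      dist ((f i : X →ᵇ ℝ) (p.1 (p.2 (i + 1)))) ((f i : X →ᵇ ℝ) (p.1 (p.2 i))) := by
  refine continuous_finsetSum _ fun i _ => ?_
  have h : ∀ j : ℕ, Continuous fun p : C(I, X) × (ℕ → I) => (f i : X →ᵇ ℝ) (p.1 (p.2 j)) :=
    fun j => (f i : X →ᵇ ℝ).continuous.comp
      (continuous_eval.comp (continuous_fst.prodMk ((continuous_apply j).comp continuous_snd)))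
  exact (h _).dist (h _)

theorem continuous_incrementSup (f : ℕ → LipB d) (n : ℕ) : Continuous (incrementSup f n) :=
  isCompact_monotone_seq.continuous_sSup (continuous_increments f n)

theorem exists_incrementSup_eq (f : ℕ → LipB d) (n : ℕ) (γ : C(I, X)) :
    ∃ u : ℕ → I, Monotone u ∧ incrementSup f n γ = ∑ i ∈ Finset.range n,
      dist ((f i : X →ᵇ ℝ) (γ (u (i + 1)))) ((f i : X →ᵇ ℝ) (γ (u i))) := by
  obtain ⟨u, hu, h⟩ := isCompact_monotone_seq.exists_sSup_image_eq
    ⟨fun _ => 0, monotone_const⟩ (f := fun u : ℕ → I => ∑ i ∈ Finset.range n,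
    dist ((f i : X →ᵇ ℝ) (γ (u (i + 1)))) ((f i : X →ᵇ ℝ) (γ (u i))))
    (((continuous_increments f n).comp (Continuous.prodMk_right γ)).continuousOn)
  exact ⟨u, hu, h⟩

theorem le_incrementSup (f : ℕ → LipB d) (n : ℕ) (γ : C(I, X)) {u : ℕ → I} (hu : Monotone u) :
    ∑ i ∈ Finset.range n, dist ((f i : X →ᵇ ℝ) (γ (u (i + 1)))) ((f i : X →ᵇ ℝ) (γ (u i)))
      ≤ incrementSup f n γ :=
  le_csSup (isCompact_monotone_seq.bddAbove_image
    (((continuous_increments f n).comp (Continuous.prodMk_right γ)).continuousOn))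
    (mem_image_of_mem _ hu)

theorem incrementSup_comp (f : ℕ → LipB d) (n : ℕ) (γ : C(I, X)) (W : C(I, I))
    (hW : Monotone W) (hs : Function.Surjective W) :
    incrementSup f n (γ.comp W) = incrementSup f n γ := by
  refine le_antisymm ?_ ?_
  · obtain ⟨u, hu, h⟩ := exists_incrementSup_eq f n (γ.comp W)
    rw [h]
    exact le_incrementSup f n γ (hW.comp hu)
  · obtain ⟨u, hu, h⟩ := exists_incrementSup_eq f n γ
    rw [h]
    obtain ⟨g, hg⟩ := hs.hasRightInverse
    have hgm : Monotone g := fun x y hxy => by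
      by_contra hlt
      have h1 := hW (not_le.1 hlt).le
      rw [hg, hg] at h1
      exact hlt (by rw [le_antisymm hxy h1])
    have := le_incrementSup f n (γ.comp W) (hgm.comp hu)
    simpa only [ContinuousMap.comp_apply, Function.comp_apply, hg _] using this

theorem CurveRel.incrementSup_eq {γ η : C(I, X)} (h : CurveRel γ η) (f : ℕ → LipB d) (n : ℕ) :
    incrementSup f n γ = incrementSup f n η := by
  obtain ⟨φ, ψ, hφ, hφs, hψ, hψs, h⟩ := h
  rw [← incrementSup_comp f n γ φ hφ hφs, h, incrementSup_comp f n η ψ hψ hψs]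

theorem continuous_incrementSup_curve (f : ℕ → LipB d) (n : ℕ) :
    Continuous fun a : RectArc d => incrementSup f n a.curve := by
  let P : Arc X → ℝ := Quot.lift (incrementSup f n) fun _ _ h => h.incrementSup_eq f n
  have hP : Continuous P := by
    exact continuous_quot_lift _ (continuous_incrementSup f n)
  have : (fun a : RectArc d => incrementSup f n a.curve) = fun a => P a.1 := by
    funext a
    rw [← a.mk_curve]
    rfl
  rw [this]
  exact hP.comp continuous_rectArc_val

theorem sum_iSup_le_iSup_sum {ι : Type*} [Nonempty ι] (g : ℕ → ι → ℝ≥0∞) (n : ℕ) :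
    ∑ i ∈ Finset.range n, ⨆ j, g i j ≤ ⨆ j : ℕ → ι, ∑ i ∈ Finset.range n, g i (j i) := by
  classical
  induction n with
  | zero => simp
  | succ n ih =>
    rw [Finset.sum_range_succ]
    refine (add_le_add_left ih _).trans ?_
    rw [ENNReal.iSup_add]
    refine iSup_le fun j => ?_
    rw [ENNReal.add_iSup]
    refine iSup_le fun k => ?_
    refine le_iSup_of_le (Function.update j n k) ?_
    rw [Finset.sum_range_succ, Function.update_self]
    refine add_le_add_left (le_of_eq (Finset.sum_congr rfl fun i hi => ?_)) _
    rw [Function.update_of_ne (Finset.mem_range.1 hi).ne]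

variable (d) in
/-- The functions of `Lip_b(X, τ, d)` with Lipschitz constant at most one. -/
abbrev UnitLip : Type _ := {f : LipB d // lipConst d (f : X →ᵇ ℝ) univ ≤ 1}

instance : Nonempty (UnitLip d) := ⟨⟨0, by
  refine iSup₂_le fun x _ => iSup₂_le fun y _ => iSup_le fun _ => ?_
  simp⟩⟩

/-- The length of an arc is the supremum of the continuous functionals `incrementSup`. -/
theorem IsEMTSpace.isLUB_incrementSup (hd : IsEMTSpace d) (a : RectArc d) :
    IsLUB (range fun p : (ℕ → UnitLip d) × ℕ => incrementSup (fun i => (p.1 i).1) p.2 a.curve)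
      a.len.toReal := by
  have key : ∀ (f : ℕ → UnitLip d) (n : ℕ) (u : ℕ → I),
      ENNReal.ofReal (∑ i ∈ Finset.range n, dist (((f i).1 : X →ᵇ ℝ) (a.curve (u (i + 1))))
        (((f i).1 : X →ᵇ ℝ) (a.curve (u i)))) = ∑ i ∈ Finset.range n,
        edist (((f i).1 : X →ᵇ ℝ) (a.curve (u (i + 1)))) (((f i).1 : X →ᵇ ℝ) (a.curve (u i))) :=
    fun f n u => by
      rw [ENNReal.ofReal_sum_of_nonneg fun _ _ => dist_nonneg]
      simp only [edist_dist]
  constructor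
  · rintro _ ⟨⟨f, n⟩, rfl⟩
    obtain ⟨u, hu, h⟩ := exists_incrementSup_eq (fun i => (f i).1) n a.curve
    rw [← ENNReal.ofReal_le_iff_le_toReal a.len_ne_top]
    dsimp only
    rw [h, key]
    refine le_trans (Finset.sum_le_sum fun i _ =>
      edist_le_dist_of_lipConst_le_one (f i).2 _ _) ?_
    exact eVariationOn.sum_le (f := d.toSpace ∘ a.curve) hu fun i => show u i ≤ 1 from (u i).2.2
  · intro c hc
    refine ENNReal.toReal_le_of_le_ofReal ?_ ?_
    · refine le_trans ?_ (hc ⟨(fun _ => Classical.arbitrary _, 0), rfl⟩)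
      obtain ⟨u, -, h⟩ := exists_incrementSup_eq
        (fun _ => (Classical.arbitrary (UnitLip d)).1) 0 a.curve
      dsimp only
      rw [h, Finset.sum_range_zero]
    refine iSup_le fun p => ?_
    have h1 : ∀ i, edist ((d.toSpace ∘ a.curve) (p.2.1 (i + 1))) ((d.toSpace ∘ a.curve) (p.2.1 i))
        = ⨆ f : UnitLip d, edist ((f.1 : X →ᵇ ℝ) (a.curve (p.2.1 (i + 1))))
          ((f.1 : X →ᵇ ℝ) (a.curve (p.2.1 i))) := fun i => by
      rw [iSup_subtype]
      exact hd.dist_eq _ _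
    simp only [h1]
    refine (sum_iSup_le_iSup_sum _ _).trans (iSup_le fun f => ?_)
    rw [← key]
    exact ENNReal.ofReal_le_ofReal ((le_incrementSup _ _ _ p.2.2.1).trans (hc ⟨(f, p.1), rfl⟩))

end Semicontinuity

/-! ### A Lusin property for suprema of continuous functions -/

section Lusin

variable {Y : Type*} [TopologicalSpace Y] [MeasurableSpace Y] [BorelSpace Y]

/-- For an inner regular finite measure, an open set covered by a family of open sets is covered,
up to a null set, by a countable subfamily. -/
theorem exists_countable_null_diff_iUnion (P : Measure Y) [IsFiniteMeasure P] [P.InnerRegular]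
    {ι : Type*} (U : ι → Set Y) (hU : ∀ i, IsOpen (U i)) :
    ∃ S : Set ι, S.Countable ∧ P ((⋃ i, U i) \ ⋃ i ∈ S, U i) = 0 := by
  have hm : MeasurableSet (⋃ i, U i) := (isOpen_iUnion hU).measurableSet
  have h : ∀ n : ℕ, ∃ T : Finset ι, P ((⋃ i, U i) \ ⋃ i ∈ T, U i) ≤ ((n : ℝ≥0∞) + 1)⁻¹ := by
    intro n
    obtain ⟨K, hKU, hK, hlt⟩ := hm.exists_isCompact_lt_add (μ := P)
      (ε := ((n : ℝ≥0∞) + 1)⁻¹) (measure_ne_top _ _)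
      (ENNReal.inv_ne_zero.2 (by finiteness))
    obtain ⟨T, hT⟩ := hK.elim_finite_subcover U hU hKU
    refine ⟨T, ?_⟩
    have hsub : (⋃ i ∈ T, U i) ⊆ ⋃ i, U i := iUnion₂_subset fun i _ => subset_iUnion U i
    have hTm : MeasurableSet (⋃ i ∈ T, U i) :=
      (isOpen_biUnion fun i _ => hU i).measurableSet
    rw [measure_sdiff hsub hTm.nullMeasurableSet (measure_ne_top _ _)]
    exact tsub_le_iff_left.2 (hlt.le.trans (add_le_add_left (measure_mono hT) _))
  choose T hT using h
  refine ⟨⋃ n, (T n : Set ι), countable_iUnion fun n => (T n).countable_toSet, ?_⟩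
  refine le_antisymm (ge_of_tendsto' (x := atTop) (f := fun n : ℕ => ((n : ℝ≥0∞) + 1)⁻¹) ?_
    fun n => ?_) bot_le
  · have := ENNReal.tendsto_inv_nat_nhds_zero.comp (tendsto_add_atTop_nat 1)
    simpa [Function.comp_def] using this
  · refine (measure_mono (sdiff_subset_sdiff_right ?_)).trans (hT n)
    exact biUnion_subset_biUnion_left (subset_iUnion (fun n => (T n : Set ι)) n)

/-- A pointwise supremum of an arbitrary family of continuous functions is the supremum of a
countable subfamily almost everywhere, hence, by Egorov's theorem, continuous on the complement of
a set of small measure. -/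
theorem exists_continuousOn_compl_of_isLUB (P : Measure Y) [IsFiniteMeasure P] [P.InnerRegular]
    {ι : Type*} [Nonempty ι] (G : ι → Y → ℝ) (hG : ∀ i, Continuous (G i)) (g : Y → ℝ)
    (hg : ∀ y, IsLUB (range fun i => G i y) (g y)) {ε : ℝ} (hε : 0 < ε) :
    ∃ t, MeasurableSet t ∧ P t ≤ ENNReal.ofReal ε ∧ ContinuousOn g tᶜ := by
  have hU : ∀ (q : ℚ) (i : ι), IsOpen {y | (q : ℝ) < G i y} := fun q i =>
    isOpen_lt continuous_const (hG i)
  have hlt : ∀ q : ℚ, {y | (q : ℝ) < g y} = ⋃ i, {y | (q : ℝ) < G i y} := fun q => by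
    ext y
    simp only [mem_ofPred_eq, mem_iUnion, lt_isLUB_iff (hg y), mem_range, exists_exists_eq_and]
  have hgm : Measurable g := by
    have : LowerSemicontinuous g := by
      intro y c hc
      obtain ⟨q, hcq, hqg⟩ := exists_rat_btwn hc
      have : IsOpen {y | (q : ℝ) < g y} := by
        rw [hlt]
        exact isOpen_iUnion (hU q)
      exact (this.eventually_mem (show y ∈ {y | (q : ℝ) < g y} from hqg)).mono
        fun z hz => hcq.trans hz
    exact this.measurable
  choose S hS hS0 using fun q : ℚ => exists_countable_null_diff_iUnion P _ (hU q)
  obtain ⟨j, hj⟩ : ∃ j : ℕ → ι, insert (Classical.arbitrary ι) (⋃ q, S q) = range j :=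
    ((countable_iUnion hS).insert _).exists_eq_range (insert_nonempty _ _)
  have hae : ∀ᵐ y ∂P, Tendsto (fun n => partialSups (fun k => G (j k)) n y) atTop (𝓝 (g y)) := by
    have h1 : ∀ᵐ y ∂P, ∀ q : ℚ, y ∉ (⋃ i, {y | (q : ℝ) < G i y}) \
        ⋃ i ∈ S q, {y | (q : ℝ) < G i y} :=
      ae_all_iff.2 fun q => measure_eq_zero_iff_ae_notMem.1 (hS0 q)
    filter_upwards [h1] with y hy
    refine tendsto_atTop_isLUB
      (fun m n hmn => (partialSups fun k => G (j k)).monotone hmn y) ⟨?_, ?_⟩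
    · rintro _ ⟨n, rfl⟩
      simp only [Pi.partialSups_apply]
      exact partialSups_le _ _ _ fun k _ => (hg y).1 ⟨j k, rfl⟩
    · intro c hc
      by_contra! hlt'
      obtain ⟨q, hcq, hqg⟩ := exists_rat_btwn hlt'
      have hmem : y ∈ ⋃ i, {y | (q : ℝ) < G i y} := by
        rw [← hlt]
        exact hqg
      have hmem' : y ∈ ⋃ i ∈ S q, {y | (q : ℝ) < G i y} := by
        by_contra hn
        exact hy q ⟨hmem, hn⟩
      simp only [mem_iUnion] at hmem'
      obtain ⟨i, hi, hqi⟩ := hmem'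
      obtain ⟨k, rfl⟩ : i ∈ range j := hj ▸ mem_insert_of_mem _ (mem_iUnion.2 ⟨q, hi⟩)
      have h2 : G (j k) y ≤ c := (le_partialSups (fun k => G (j k)) k y).trans (hc ⟨k, rfl⟩)
      exact absurd (hcq.trans hqi) (not_lt.2 h2)
  have hcont : ∀ n, Continuous (partialSups (fun k => G (j k)) n) := fun n =>
    Continuous.partialSups fun k _ => hG (j k)
  obtain ⟨t, ht, htε, hunif⟩ := tendstoUniformlyOn_of_ae_tendsto'
    (fun n => (hcont n).measurable.stronglyMeasurable) hgm.stronglyMeasurable hae hε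
  exact ⟨t, ht, htε, hunif.continuousOn (Frequently.of_forall fun n => (hcont n).continuousOn)⟩

end Lusin

/-! ### Measurability of the evaluation map -/

section Evaluation

variable {X : Type*} [TopologicalSpace X] {d : ExtDist X}

theorem RectArc.dist_comp_param_le (hd : IsEMTSpace d) (a : RectArc d) {f : X → ℝ} {K : ℝ≥0}
    (hK : LipschitzWith K (f ∘ d.ofSpace)) (s t : I) :
    dist (f (a.param s)) (f (a.param t)) ≤ K * (a.len.toReal * |(s : ℝ) - t|) := by
  have h := (hK (d.toSpace (a.param s)) (d.toSpace (a.param t))).trans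
    (mul_le_mul_right (a.dist_param_le hd s t) _)
  have hf : ∀ r, (f ∘ d.ofSpace) (d.toSpace (a.param r)) = f (a.param r) := fun _ => rfl
  rw [hf, hf, ← ENNReal.ofReal_toReal a.len_ne_top, Subtype.edist_eq, edist_dist, edist_dist,
    Real.dist_eq (s : ℝ), ← ENNReal.ofReal_mul ENNReal.toReal_nonneg, ← ENNReal.ofReal_coe_nnreal,
    ← ENNReal.ofReal_mul K.coe_nonneg] at h
  exact (ENNReal.ofReal_le_ofReal_iff (by positivity)).1 h

/-- Where the length is continuous, the arc-length evaluation map is jointly continuous. -/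
theorem IsEMTSpace.continuousOn_evalMap (hd : IsEMTSpace d) {A : Set (RectArc d)}
    (hA : ContinuousOn (fun a : RectArc d => a.len.toReal) A) :
    ContinuousOn (evalMap d) (A ×ˢ univ) := by
  rintro ⟨a, t⟩ ⟨haA, -⟩
  refine hd.tendsto_iff.2 fun f => Metric.tendsto_nhds.2 fun ε hε => ?_
  obtain ⟨K, hK⟩ := f.2
  obtain ⟨δ, hδ, hδ1, hδε⟩ : ∃ δ : ℝ, 0 < δ ∧ δ ≤ 1 ∧ (4 * K + 1) * δ ≤ ε := by
    have hpos : (0 : ℝ) < 4 * K + 1 := by positivity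
    refine ⟨min 1 (ε / (4 * K + 1)), lt_min one_pos (by positivity), min_le_left _ _, ?_⟩
    calc (4 * K + 1) * min 1 (ε / (4 * K + 1)) ≤ (4 * K + 1) * (ε / (4 * K + 1)) := by
          gcongr; exact min_le_right _ _
      _ = ε := by field_simp
  -- With `l = ℓ(a)`, nearby arcs `b ∈ A` visit, at a time `r`, a point where `f` is `δ`-close to
  -- `f (R_a t)`, with pieces longer than `l t - δ` and `l (1 - t) - δ`. As `ℓ(b)` is `δ`-close to
  -- `l`, this forces `ℓ(b) |s - r| ≤ 4 δ` for all `s` close to `t`, and `f` changes by at most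
  -- `4 K δ` between the times `r` and `s`.
  set l := a.len.toReal with hl
  have hl0 : 0 ≤ l := ENNReal.toReal_nonneg
  have hfst : Tendsto (Prod.fst : RectArc d × I → RectArc d) (𝓝[A ×ˢ univ] (a, t)) (𝓝[A] a) :=
    tendsto_nhdsWithin_of_tendsto_nhds_of_eventually_within _
      (continuous_fst.tendsto' _ _ rfl |>.mono_left nhdsWithin_le_nhds)
      (eventually_mem_nhdsWithin.mono fun p hp => hp.1)
  have h1 : ∀ᶠ p : RectArc d × I in 𝓝[A ×ˢ univ] (a, t), |p.1.len.toReal - l| < δ :=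
    hfst.eventually ((hA a haA).eventually (Metric.ball_mem_nhds _ hδ))
  have h2 : ∀ᶠ p : RectArc d × I in 𝓝[A ×ˢ univ] (a, t), |(p.2 : ℝ) - t| * (l + 1) < δ := by
    have hc : Continuous fun p : RectArc d × I => |(p.2 : ℝ) - t| * (l + 1) := by fun_prop
    refine (hc.continuousAt.eventually_lt_const ?_).filter_mono nhdsWithin_le_nhds
    simpa using hδ
  let O : Set X := {x | dist ((f : X →ᵇ ℝ) x) ((f : X →ᵇ ℝ) (a.param t)) < δ}
  have hO : IsOpen O := isOpen_lt ((f : X →ᵇ ℝ).continuous.dist continuous_const) continuous_const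
  have hlt : ∀ x : ℝ≥0∞, x ≠ ∞ → x < x + ENNReal.ofReal δ := fun x hx =>
    ENNReal.lt_add_right hx (ENNReal.ofReal_pos.2 hδ).ne'
  have h3 := hfst.eventually (nhdsWithin_le_nhds ((hd.isOpen_visit (a.len * ENNReal.ofReal t)
    (a.len * ENNReal.ofReal (1 - t)) (ENNReal.ofReal δ) hO).mem_nhds (x := a)
    ⟨t, hlt _ (ENNReal.mul_ne_top a.len_ne_top ENNReal.ofReal_ne_top),
      hlt _ (ENNReal.mul_ne_top a.len_ne_top ENNReal.ofReal_ne_top), by simpa [O] using hδ⟩))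
  filter_upwards [h1, h2, h3] with p hp1 hp2 ⟨r, hr1, hr2, hr3⟩
  obtain ⟨b, s⟩ := p
  dsimp only at hp1 hp2 hr1 hr2 hr3
  set l' := b.len.toReal with hl'
  have hl'0 : 0 ≤ l' := ENNReal.toReal_nonneg
  have hconv : ∀ (x y : ℝ), 0 ≤ x → 0 ≤ y →
      a.len * ENNReal.ofReal x < b.len * ENNReal.ofReal y + ENNReal.ofReal δ →
      l * x < l' * y + δ := by
    intro x y hx hy h
    rw [← ENNReal.ofReal_toReal a.len_ne_top, ← ENNReal.ofReal_toReal b.len_ne_top,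
      ← ENNReal.ofReal_mul hl0, ← ENNReal.ofReal_mul hl'0,
      ← ENNReal.ofReal_add (by positivity) hδ.le] at h
    exact (ENNReal.ofReal_lt_ofReal_iff_of_nonneg (by positivity)).1 h
  have e1 := hconv _ _ t.2.1 r.2.1 hr1
  have e2 := hconv _ _ (sub_nonneg.2 t.2.2) (sub_nonneg.2 r.2.2) hr2
  have ht0 := t.2.1
  have ht1 := t.2.2
  have hlip : dist ((f : X →ᵇ ℝ) (b.param s)) ((f : X →ᵇ ℝ) (b.param r)) ≤
      K * (l' * |(s : ℝ) - r|) := b.dist_comp_param_le hd hK s r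
  rw [abs_lt] at hp1
  have e3 : l' * |(s : ℝ) - t| ≤ δ := by
    have : l' ≤ l + 1 := by linarith [hp1.2]
    nlinarith [abs_nonneg ((s : ℝ) - t)]
  have e4 : l' * |(s : ℝ) - r| ≤ 4 * δ := by
    rw [← abs_of_nonneg hl'0, ← abs_mul, abs_le] at e3 ⊢
    constructor <;> nlinarith [e3.1, e3.2, e1, e2, hp1.1, hp1.2]
  have hK0 := K.2
  calc dist ((f : X →ᵇ ℝ) (evalMap d (b, s))) ((f : X →ᵇ ℝ) (evalMap d (a, t)))
      ≤ dist ((f : X →ᵇ ℝ) (b.param s)) ((f : X →ᵇ ℝ) (b.param r)) +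
        dist ((f : X →ᵇ ℝ) (b.param r)) ((f : X →ᵇ ℝ) (a.param t)) := dist_triangle _ _ _
    _ < K * (4 * δ) + δ := add_lt_add_of_le_of_lt
        (hlip.trans (mul_le_mul_of_nonneg_left e4 hK0)) hr3
    _ ≤ ε := by linarith

/-- The Lusin property of the length with respect to a dynamic plan. -/
theorem IsDynamicPlan.exists_continuousOn_len (hd : IsEMTSpace d) {π : Measure (RectArc d)}
    (hπ : IsDynamicPlan d π) {ε : ℝ} (hε : 0 < ε) :
    ∃ t, MeasurableSet t ∧ π t ≤ ENNReal.ofReal ε ∧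
      ContinuousOn (fun a : RectArc d => a.len.toReal) tᶜ := by
  have := hπ.finite
  have := hπ.radon
  exact exists_continuousOn_compl_of_isLUB π _
    (fun p : (ℕ → UnitLip d) × ℕ => continuous_incrementSup_curve (fun i => (p.1 i).1) p.2) _
    hd.isLUB_incrementSup hε

/-- A dynamic plan is concentrated on a countable union of Borel sets on which the length is
continuous. -/
theorem IsDynamicPlan.exists_seq_continuousOn_len (hd : IsEMTSpace d) {π : Measure (RectArc d)}
    (hπ : IsDynamicPlan d π) : ∃ A : ℕ → Set (RectArc d), (∀ n, MeasurableSet (A n)) ∧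
      (∀ n, ContinuousOn (fun a : RectArc d => a.len.toReal) (A n)) ∧ π (⋃ n, A n)ᶜ = 0 := by
  choose t ht htε hc using fun n : ℕ =>
    hπ.exists_continuousOn_len hd (Nat.one_div_pos_of_nat (α := ℝ) (n := n))
  refine ⟨fun n => (t n)ᶜ, fun n => (ht n).compl, hc, ?_⟩
  refine le_antisymm (ge_of_tendsto' (x := atTop)
    (f := fun n : ℕ => ENNReal.ofReal (1 / ((n : ℝ) + 1))) ?_ fun n => ?_) bot_le
  · have := ENNReal.tendsto_ofReal tendsto_one_div_add_atTop_nhds_zero_nat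
    simpa using this
  · refine (measure_mono ?_).trans (htε n)
    rw [compl_subset_comm]
    exact subset_iUnion (fun n => (t n)ᶜ) n

/-- Functions on `RA(X, d) × [0, 1]` that are continuous wherever the length is are measurable
with respect to the product of a dynamic plan and the Lebesgue measure. -/
theorem IsDynamicPlan.aemeasurable_of_continuousOn (hd : IsEMTSpace d) {π : Measure (RectArc d)}
    (hπ : IsDynamicPlan d π) {Z : Type*} [TopologicalSpace Z] [MeasurableSpace Z] [BorelSpace Z]
    {F : RectArc d × I → Z}
    (hF : ∀ A : Set (RectArc d), ContinuousOn (fun a : RectArc d => a.len.toReal) A →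
      ContinuousOn F (A ×ˢ univ)) : AEMeasurable F (planHat π) := by
  have := hπ.finite
  obtain ⟨A, hAm, hAc, hA0⟩ := hπ.exists_seq_continuousOn_len hd
  have hnull : planHat π (⋃ n, A n ×ˢ (univ : Set I))ᶜ = 0 := by
    rw [← iUnion_prod_const]
    have : ((⋃ n, A n) ×ˢ (univ : Set I))ᶜ = (⋃ n, A n)ᶜ ×ˢ univ := by
      rw [prod_univ, prod_univ, preimage_compl]
    rw [this, planHat, Measure.prod_prod, hA0, zero_mul]
  rw [← Measure.restrict_eq_self_of_ae_mem (s := ⋃ n, A n ×ˢ (univ : Set I))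
    (μ := planHat π) (by exact mem_ae_iff.2 hnull)]
  exact aemeasurable_iUnion_iff.2 fun n =>
    (hF _ (hAc n)).aemeasurable ((hAm n).prod MeasurableSet.univ)

theorem IsDynamicPlan.aemeasurable_evalMap_comp [MeasurableSpace X] [BorelSpace X]
    (hd : IsEMTSpace d) {π : Measure (RectArc d)} (hπ : IsDynamicPlan d π) {θ : I → I}
    (hθ : Continuous θ) : AEMeasurable (fun p => evalMap d (p.1, θ p.2)) (planHat π) :=
  hπ.aemeasurable_of_continuousOn hd fun _ hA => (hd.continuousOn_evalMap hA).comp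
    (by fun_prop) fun _ hp => ⟨hp.1, mem_univ _⟩

theorem IsDynamicPlan.aemeasurable_evalAt [MeasurableSpace X] [BorelSpace X]
    (hd : IsEMTSpace d) {π : Measure (RectArc d)} (hπ : IsDynamicPlan d π) (t : I) :
    AEMeasurable (evalAt d t) π := by
  obtain ⟨A, hAm, hAc, hA0⟩ := hπ.exists_seq_continuousOn_len hd
  rw [← Measure.restrict_eq_self_of_ae_mem (s := ⋃ n, A n) (μ := π) (by exact mem_ae_iff.2 hA0)]
  refine aemeasurable_iUnion_iff.2 fun n => ContinuousOn.aemeasurable ?_ (hAm n)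
  exact (hd.continuousOn_evalMap (hAc n)).comp (f := fun a : RectArc d => (a, t))
    (by fun_prop) fun a ha => ⟨ha, mem_univ _⟩

theorem IsEMTSpace.measurable_len (hd : IsEMTSpace d) :
    Measurable fun a : RectArc d => a.len := by
  have h : Measurable fun a : RectArc d => a.len.toReal := by
    refine LowerSemicontinuous.measurable fun a c hc => ?_
    obtain ⟨_, ⟨p, rfl⟩, hp⟩ := (lt_isLUB_iff (hd.isLUB_incrementSup a)).1 hc
    filter_upwards [(continuous_incrementSup_curve _ _).continuousAt.eventually_const_lt hp]
      with b hb
    exact hb.trans_le ((hd.isLUB_incrementSup b).1 ⟨p, rfl⟩)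
  have h2 : (fun a : RectArc d => a.len) = fun a => ENNReal.ofReal a.len.toReal := by
    funext a
    exact (ENNReal.ofReal_toReal a.len_ne_top).symm
  rw [h2]
  exact h.ennreal_ofReal

end Evaluation

/-! ### The derivative of a Lipschitz function along an arc -/

section ArcDeriv

variable {X : Type*} [TopologicalSpace X] {d : ExtDist X}

theorem abs_limsup_le {ι : Type*} {l : Filter ι} [l.NeBot] {u : ι → ℝ} {c : ℝ}
    (h : ∀ᶠ i in l, |u i| ≤ c) : |limsup u l| ≤ c := by
  have hle : ∀ᶠ i in l, u i ≤ c := h.mono fun i hi => (abs_le.1 hi).2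
  have hge : ∀ᶠ i in l, -c ≤ u i := h.mono fun i hi => (abs_le.1 hi).1
  exact abs_le.2 ⟨le_limsup_of_frequently_le hge.frequently (isBoundedUnder_of_eventually_le hle),
    limsup_le_of_le (isBoundedUnder_of_eventually_ge hge).isCoboundedUnder_flip hle⟩

theorem abs_sub_param_le (hd : IsEMTSpace d) {f : X → ℝ} {U : Set X} {c : ℝ}
    (hc : lipConst d f U < ENNReal.ofReal c) (a : RectArc d) {s t : I} (hs : a.param s ∈ U)
    (ht : a.param t ∈ U) :
    |f (a.param s) - f (a.param t)| ≤ c * (a.len.toReal * |(s : ℝ) - t|) := by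
  have hc0 : 0 < c := ENNReal.ofReal_pos.1 (bot_le.trans_lt hc)
  have hfin : d.dist (a.param s) (a.param t) ≤ ENNReal.ofReal (a.len.toReal * |(s : ℝ) - t|) := by
    refine (a.dist_param_le hd s t).trans_eq ?_
    rw [ENNReal.ofReal_mul ENNReal.toReal_nonneg, ENNReal.ofReal_toReal a.len_ne_top,
      Subtype.edist_eq, edist_dist, Real.dist_eq]
  by_cases hxy : a.param s = a.param t
  · rw [hxy, sub_self, abs_zero]
    have := ENNReal.toReal_nonneg (a := a.len)
    positivity
  have h0 : d.dist (a.param s) (a.param t) ≠ 0 := fun h => hxy (d.eq_of_dist_eq_zero _ _ h)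
  have h1 : edist (f (a.param s)) (f (a.param t)) / d.dist (a.param s) (a.param t) ≤
      ENNReal.ofReal c := by
    refine le_trans ?_ hc.le
    exact le_iSup_of_le _ (le_iSup_of_le hs (le_iSup_of_le _
      (le_iSup_of_le ht (le_iSup_of_le hxy le_rfl))))
  rw [ENNReal.div_le_iff h0 (hfin.trans_lt ENNReal.ofReal_lt_top).ne] at h1
  have h2 := h1.trans (mul_le_mul_right hfin _)
  rw [← ENNReal.ofReal_mul hc0.le, edist_dist, Real.dist_eq] at h2
  refine (ENNReal.ofReal_le_ofReal_iff ?_).1 h2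
  have := ENNReal.toReal_nonneg (a := a.len)
  positivity

theorem abs_div_sub_le {x c l s t : ℝ} (hst : s ≠ t) (h : |x| ≤ c * (l * |s - t|)) :
    |x / (s - t)| ≤ c * l := by
  rw [abs_div, div_le_iff₀ (abs_pos.2 (sub_ne_zero.2 hst)), mul_assoc]
  exact h

theorem lipConst_le_of_lipschitzWith {X : Type*} {d : ExtDist X} {f : X → ℝ} {K : ℝ≥0}
    (hK : LipschitzWith K (f ∘ d.ofSpace)) (A : Set X) : lipConst d f A ≤ K := by
  refine iSup₂_le fun x _ => iSup₂_le fun y _ => iSup_le fun _ => ?_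
  exact ENNReal.div_le_of_le_mul (hK (d.toSpace x) (d.toSpace y))

theorem asympSlope_lt_top (f : LipB d) (x : X) : asympSlope d (f : X →ᵇ ℝ) x < ∞ := by
  obtain ⟨K, hK⟩ := f.2
  exact (iInf₂_le_of_le univ isOpen_univ (iInf_le_of_le (mem_univ x)
    (lipConst_le_of_lipschitzWith hK univ))).trans_lt ENNReal.coe_lt_top

theorem upperSemicontinuous_asympSlope (f : X → ℝ) : UpperSemicontinuous (asympSlope d f) := by
  intro x c hc
  simp only [asympSlope, iInf_lt_iff] at hc
  obtain ⟨U, hU, hx, hlt⟩ := hc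
  filter_upwards [hU.mem_nhds hx] with y hy
  exact (iInf₂_le_of_le U hU (iInf_le _ hy)).trans_lt hlt

/-- Since `R_γ` is `τ`-continuous and `ℓ(γ)`-Lipschitz, the derivative of `f` along `γ` is
controlled by the asymptotic slope of `f` times the length of `γ`. -/
theorem IsEMTSpace.abs_arcDeriv_le (hd : IsEMTSpace d) (f : LipB d) (p : RectArc d × I) :
    |arcDeriv d (f : X →ᵇ ℝ) p| ≤
      (asympSlope d (f : X →ᵇ ℝ) (evalMap d p)).toReal * p.1.len.toReal := by
  have hl := ENNReal.toReal_nonneg (a := p.1.len)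
  have hs := ENNReal.toReal_nonneg (a := asympSlope d (f : X →ᵇ ℝ) (evalMap d p))
  set l := p.1.len.toReal
  set r := (asympSlope d (f : X →ᵇ ℝ) (evalMap d p)).toReal with hr
  refine le_of_forall_pos_le_add fun ε hε => ?_
  have hc : asympSlope d (f : X →ᵇ ℝ) (evalMap d p) < ENNReal.ofReal (r + ε / (l + 1)) := by
    rw [← ENNReal.ofReal_toReal (asympSlope_lt_top f (evalMap d p)).ne]
    exact (ENNReal.ofReal_lt_ofReal_iff (by positivity)).2 (lt_add_of_pos_right _ (by positivity))
  simp only [asympSlope, iInf_lt_iff] at hc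
  obtain ⟨U, hU, hx, hlt⟩ := hc
  have hnhds : ∀ᶠ s : I in 𝓝 p.2, p.1.param s ∈ U :=
    p.1.param.continuous.continuousAt.eventually_mem (hU.mem_nhds hx)
  have hle : |arcDeriv d (f : X →ᵇ ℝ) p| ≤ (r + ε / (l + 1)) * l := by
    refine abs_limsup_le ?_
    filter_upwards [nhdsWithin_le_nhds hnhds, self_mem_nhdsWithin] with s hs hne
    exact abs_div_sub_le (fun h => hne (Subtype.ext h)) (abs_sub_param_le hd hlt p.1 hs hx)
  refine hle.trans ?_
  rw [add_mul]
  gcongr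
  rw [div_mul_eq_mul_div, div_le_iff₀ (by positivity)]
  nlinarith

/-- The function `f ∘ R_γ`, extended to `ℝ` by constants. -/
noncomputable def alongArc (f : X → ℝ) (a : RectArc d) : ℝ → ℝ :=
  IccExtend (zero_le_one (α := ℝ)) fun t : I => f (a.param t)

theorem alongArc_coe (f : X → ℝ) (a : RectArc d) (t : I) : alongArc f a t = f (a.param t) :=
  IccExtend_val _ _ t

theorem IsEMTSpace.lipschitzWith_alongArc (hd : IsEMTSpace d) {f : X → ℝ} {K : ℝ≥0}
    (hK : LipschitzWith K (f ∘ d.ofSpace)) (a : RectArc d) :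
    LipschitzWith (K * a.len.toNNReal) (alongArc f a) := by
  have h1 : LipschitzWith (K * a.len.toNNReal) fun t : I => f (a.param t) :=
    LipschitzWith.of_dist_le_mul fun s t => by
      rw [NNReal.coe_mul, mul_assoc]
      exact a.dist_comp_param_le hd hK s t
  simpa using! h1.comp (LipschitzWith.projIcc zero_le_one)

theorem arcDeriv_eq_of_hasDerivAt {f : X → ℝ} {p : RectArc d × I} {D : ℝ}
    (h : HasDerivAt (alongArc f p.1) D p.2) : arcDeriv d f p = D := by
  have h1 : Tendsto (fun s : I => (s : ℝ)) (𝓝[≠] p.2) (𝓝[≠] (p.2 : ℝ)) :=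
    tendsto_nhdsWithin_of_tendsto_nhds_of_eventually_within _
      (continuous_subtype_val.continuousAt.tendsto.mono_left nhdsWithin_le_nhds)
      (eventually_mem_nhdsWithin.mono fun s hs h => hs (Subtype.ext h))
  have h2 := (hasDerivAt_iff_tendsto_slope.1 h).comp h1
  refine Tendsto.limsup_eq (h2.congr fun s => ?_)
  simp only [Function.comp_apply, slope_def_field, alongArc_coe]

theorem IsEMTSpace.ae_differentiableAt_alongArc (hd : IsEMTSpace d) (f : LipB d)
    (a : RectArc d) : ∀ᵐ t : I, DifferentiableAt ℝ (alongArc (f : X →ᵇ ℝ) a) t := by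
  obtain ⟨K, hK⟩ := f.2
  have h := (hd.lipschitzWith_alongArc hK a).ae_differentiableAt_real
  exact unitInterval.measurePreserving_coe.quasiMeasurePreserving.ae (ae_restrict_of_ae h)

/-- The fundamental theorem of calculus along an arc. -/
theorem IsEMTSpace.integral_arcDeriv (hd : IsEMTSpace d) (f : LipB d) (a : RectArc d) :
    ∫ t : I, arcDeriv d (f : X →ᵇ ℝ) (a, t) =
      (f : X →ᵇ ℝ) (a.param 1) - (f : X →ᵇ ℝ) (a.param 0) := by
  obtain ⟨K, hK⟩ := f.2
  have h1 : ∫ t : I, arcDeriv d (f : X →ᵇ ℝ) (a, t) =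
      ∫ t : I, deriv (alongArc (f : X →ᵇ ℝ) a) t :=
    integral_congr_ae ((hd.ae_differentiableAt_alongArc f a).mono fun t ht =>
      arcDeriv_eq_of_hasDerivAt (p := (a, t)) ht.hasDerivAt)
  rw [h1, unitInterval.measurePreserving_coe.integral_comp
    unitInterval.measurableEmbedding_coe (g := deriv (alongArc (f : X →ᵇ ℝ) a)),
    integral_Icc_eq_integral_Ioc, ← intervalIntegral.integral_of_le zero_le_one,
    ((hd.lipschitzWith_alongArc hK a).lipschitzOnWith.absolutelyContinuousOnInterval
      ).integral_deriv_eq_sub, ← alongArc_coe (f : X →ᵇ ℝ) a,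
    ← alongArc_coe (f : X →ᵇ ℝ) a]
  rfl

theorem IsEMTSpace.continuous_alongArc (hd : IsEMTSpace d) (f : LipB d) {A : Set (RectArc d)}
    (hA : ContinuousOn (fun a : RectArc d => a.len.toReal) A) :
    Continuous (Function.uncurry fun (a : A) (x : ℝ) => alongArc (f : X →ᵇ ℝ) a.1 x) := by
  refine (f : X →ᵇ ℝ).continuous.comp ((hd.continuousOn_evalMap hA).comp_continuous
    (f := fun p : A × ℝ => (p.1.1, projIcc (0 : ℝ) 1 zero_le_one p.2)) ?_ fun p => ?_)
  · exact (continuous_subtype_val.comp continuous_fst).prodMk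
      (continuous_projIcc.comp continuous_snd)
  · exact ⟨p.1.2, mem_univ _⟩

/-- The function `f ∘ R_γ` is differentiable at `t` for almost every pair `(γ, t)`. The exceptional
set is measurable on each piece where the length is continuous, so that Fubini applies. -/
theorem IsDynamicPlan.ae_differentiableAt (hd : IsEMTSpace d) {π : Measure (RectArc d)}
    (hπ : IsDynamicPlan d π) (f : LipB d) :
    ∀ᵐ p ∂planHat π, DifferentiableAt ℝ (alongArc (f : X →ᵇ ℝ) p.1) p.2 := by
  have := hπ.finite
  obtain ⟨A, hAm, hAc, hA0⟩ := hπ.exists_seq_continuousOn_len hd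
  have hpiece : ∀ n, ∀ᵐ p ∂planHat π, p.1 ∈ A n →
      DifferentiableAt ℝ (alongArc (f : X →ᵇ ℝ) p.1) p.2 := by
    intro n
    have hT := measurableSet_of_differentiableAt_with_param ℝ (hd.continuous_alongArc f (hAc n))
    have he : MeasurableEmbedding (Prod.map Subtype.val id : A n × I → RectArc d × I) :=
      (MeasurableEmbedding.subtype_coe (hAm n)).prodMap .id
    have hT' : MeasurableSet {p : A n × I |
        ¬ DifferentiableAt ℝ (alongArc (f : X →ᵇ ℝ) p.1.1) p.2} :=
      (hT.preimage (measurable_fst.prodMk (measurable_subtype_coe.comp measurable_snd))).compl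
    have hS := he.measurableSet_image.2 hT'
    have hSeq : Prod.map Subtype.val id '' {p : A n × I |
        ¬ DifferentiableAt ℝ (alongArc (f : X →ᵇ ℝ) p.1.1) p.2} = {p : RectArc d × I |
        ¬ (p.1 ∈ A n → DifferentiableAt ℝ (alongArc (f : X →ᵇ ℝ) p.1) p.2)} := by
      ext ⟨a, t⟩
      constructor
      · rintro ⟨⟨a', t'⟩, h, heq⟩
        obtain ⟨rfl, rfl⟩ := Prod.mk.inj heq
        exact fun h' => h (h' a'.2)
      · intro h
        obtain ⟨ha, hn⟩ := Classical.not_imp.1 h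
        exact ⟨(⟨a, ha⟩, t), hn, rfl⟩
    rw [hSeq] at hS
    have hS' : MeasurableSet {p : RectArc d × I |
        p.1 ∈ A n → DifferentiableAt ℝ (alongArc (f : X →ᵇ ℝ) p.1) p.2} := by
      simpa [compl_ofPred] using hS.compl
    exact (Measure.ae_prod_iff_ae_ae hS').2 (Eventually.of_forall fun a =>
      (hd.ae_differentiableAt_alongArc f a).mono fun t ht _ => ht)
  have hmem : ∀ᵐ p ∂planHat π, p.1 ∈ ⋃ n, A n :=
    Measure.quasiMeasurePreserving_fst.ae (mem_ae_iff.2 hA0)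
  filter_upwards [ae_all_iff.2 hpiece, hmem] with p hp hpm
  obtain ⟨n, hn⟩ := mem_iUnion.1 hpm
  exact hp n hn

theorem IsDynamicPlan.aemeasurable_arcDeriv [MeasurableSpace X] [BorelSpace X]
    (hd : IsEMTSpace d) {π : Measure (RectArc d)} (hπ : IsDynamicPlan d π) (f : LipB d) :
    AEMeasurable (arcDeriv d (f : X →ᵇ ℝ)) (planHat π) := by
  -- Almost everywhere, the derivative is the limit of forward difference quotients.
  have hlim : Tendsto (fun n : ℕ => (1 : ℝ) / ((n : ℝ) + 1)) atTop (𝓝[≠] 0) :=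
    tendsto_nhdsWithin_of_tendsto_nhds_of_eventually_within _
      tendsto_one_div_add_atTop_nhds_zero_nat
      (Eventually.of_forall fun n => (Nat.one_div_pos_of_nat (α := ℝ)).ne')
  refine aemeasurable_of_tendsto_metrizable_ae atTop
    (f := fun (n : ℕ) (p : RectArc d × I) => ((1 : ℝ) / ((n : ℝ) + 1))⁻¹ •
      (alongArc (f : X →ᵇ ℝ) p.1 (p.2 + 1 / ((n : ℝ) + 1)) - alongArc (f : X →ᵇ ℝ) p.1 p.2))
    (fun n => ?_) ?_
  · have h : ∀ c : ℝ, AEMeasurable (fun p : RectArc d × I =>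
        alongArc (f : X →ᵇ ℝ) p.1 (p.2 + c)) (planHat π) := fun c =>
      (f : X →ᵇ ℝ).continuous.measurable.comp_aemeasurable (hπ.aemeasurable_evalMap_comp hd
        (θ := fun t : I => projIcc (0 : ℝ) 1 zero_le_one (t + c))
        (continuous_projIcc.comp (by fun_prop)))
    have h0 := h 0
    simp only [add_zero] at h0
    exact ((h (1 / ((n : ℝ) + 1))).sub h0).const_mul ((1 : ℝ) / ((n : ℝ) + 1))⁻¹
  · filter_upwards [hπ.ae_differentiableAt hd f] with p hp
    rw [arcDeriv_eq_of_hasDerivAt hp.hasDerivAt]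
    exact hp.hasDerivAt.tendsto_slope_zero.comp hlim

theorem IsDynamicPlan.arcDeriv_add (hd : IsEMTSpace d) {π : Measure (RectArc d)}
    (hπ : IsDynamicPlan d π) (f g : LipB d) :
    ∀ᵐ p ∂planHat π, arcDeriv d ((f + g : LipB d) : X →ᵇ ℝ) p =
      arcDeriv d (f : X →ᵇ ℝ) p + arcDeriv d (g : X →ᵇ ℝ) p := by
  filter_upwards [hπ.ae_differentiableAt hd f, hπ.ae_differentiableAt hd g] with p hf hg
  rw [arcDeriv_eq_of_hasDerivAt hf.hasDerivAt, arcDeriv_eq_of_hasDerivAt hg.hasDerivAt]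
  exact arcDeriv_eq_of_hasDerivAt (hf.hasDerivAt.add hg.hasDerivAt)

theorem IsDynamicPlan.arcDeriv_smul (hd : IsEMTSpace d) {π : Measure (RectArc d)}
    (hπ : IsDynamicPlan d π) (c : ℝ) (f : LipB d) :
    ∀ᵐ p ∂planHat π, arcDeriv d ((c • f : LipB d) : X →ᵇ ℝ) p =
      c * arcDeriv d (f : X →ᵇ ℝ) p := by
  filter_upwards [hπ.ae_differentiableAt hd f] with p hf
  rw [arcDeriv_eq_of_hasDerivAt hf.hasDerivAt]
  exact arcDeriv_eq_of_hasDerivAt (hf.hasDerivAt.const_mul c)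

theorem IsDynamicPlan.arcDeriv_mul (hd : IsEMTSpace d) {π : Measure (RectArc d)}
    (hπ : IsDynamicPlan d π) (f g : LipB d) :
    ∀ᵐ p ∂planHat π, arcDeriv d ((f * g : LipB d) : X →ᵇ ℝ) p =
      (f : X →ᵇ ℝ) (evalMap d p) * arcDeriv d (g : X →ᵇ ℝ) p +
        (g : X →ᵇ ℝ) (evalMap d p) * arcDeriv d (f : X →ᵇ ℝ) p := by
  filter_upwards [hπ.ae_differentiableAt hd f, hπ.ae_differentiableAt hd g] with p hf hg
  rw [arcDeriv_eq_of_hasDerivAt hf.hasDerivAt, arcDeriv_eq_of_hasDerivAt hg.hasDerivAt]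
  refine arcDeriv_eq_of_hasDerivAt ((hf.hasDerivAt.mul hg.hasDerivAt).congr_deriv ?_)
  rw [alongArc_coe, alongArc_coe]
  simp only [evalMap]
  ring

theorem measurable_len_fst (hd : IsEMTSpace d) :
    Measurable fun p : RectArc d × I => p.1.len :=
  hd.measurable_len.comp measurable_fst

theorem ofReal_abs_arcDeriv_le (hd : IsEMTSpace d) (f : LipB d) (p : RectArc d × I) :
    ENNReal.ofReal |arcDeriv d (f : X →ᵇ ℝ) p| ≤
      asympSlope d (f : X →ᵇ ℝ) (evalMap d p) * p.1.len := by
  rw [← ENNReal.ofReal_toReal (asympSlope_lt_top f (evalMap d p)).ne,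
    ← ENNReal.ofReal_toReal p.1.len_ne_top, ← ENNReal.ofReal_mul ENNReal.toReal_nonneg]
  exact ENNReal.ofReal_le_ofReal (hd.abs_arcDeriv_le f p)

theorem exists_asympSlope_toReal_le (f : LipB d) :
    ∃ K : ℝ≥0, ∀ x, (asympSlope d (f : X →ᵇ ℝ) x).toReal ≤ K := by
  obtain ⟨K, hK⟩ := f.2
  refine ⟨K, fun x => ENNReal.toReal_le_coe_of_le_coe ?_⟩
  exact iInf₂_le_of_le univ isOpen_univ (iInf_le_of_le (mem_univ x)
    (lipConst_le_of_lipschitzWith hK univ))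

theorem IsDynamicPlan.lintegral_len_planHat (hd : IsEMTSpace d) {π : Measure (RectArc d)}
    (hπ : IsDynamicPlan d π) :
    ∫⁻ p, p.1.len ∂planHat π ≠ ∞ := by
  have := hπ.finite
  rw [planHat, lintegral_prod _ (measurable_len_fst hd).aemeasurable]
  simpa using hπ.lintegral_len.ne

theorem IsDynamicPlan.integrable_len (hd : IsEMTSpace d) {π : Measure (RectArc d)}
    (hπ : IsDynamicPlan d π) :
    Integrable (fun p : RectArc d × I => p.1.len.toReal) (planHat π) :=
  integrable_toReal_of_lintegral_ne_top (measurable_len_fst hd).aemeasurable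
    (hπ.lintegral_len_planHat hd)

end ArcDeriv

/-! ### Push-forwards of weighted measures and their densities -/

section Push

theorem abs_indicator_one_le {X : Type*} (B : Set X) (x : X) :
    |B.indicator (1 : X → ℝ) x| ≤ 1 := by
  by_cases hx : x ∈ B <;> simp [hx]

variable {X Y : Type*} [MeasurableSpace X] [MeasurableSpace Y]

/-- The push-forward under `e` of the measure with density `L` with respect to `P`. -/
noncomputable def pushWeight (P : Measure Y) (e : Y → X) (L : Y → ℝ≥0∞) : Measure X :=
  (P.withDensity L).map e

/-- The difference of the densities of `e_#(w⁺ P)` and `e_#(w⁻ P)`. -/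
noncomputable def signedDensity (P : Measure Y) (e : Y → X) (m : Measure X) (w : Y → ℝ)
    (x : X) : ℝ :=
  density (pushWeight P e fun y => ENNReal.ofReal (w y)) m x -
    density (pushWeight P e fun y => ENNReal.ofReal (-w y)) m x

theorem measurable_density (μ m : Measure X) : Measurable (density μ m) :=
  (Measure.measurable_rnDeriv μ m).ennreal_toReal

theorem density_nonneg (μ m : Measure X) (x : X) : 0 ≤ density μ m x := ENNReal.toReal_nonneg

variable {P : Measure Y} {e : Y → X} {m : Measure X}

theorem lintegral_pushWeight (he : AEMeasurable e P) {L : Y → ℝ≥0∞} (hL : AEMeasurable L P)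
    {g : X → ℝ≥0∞} (hg : Measurable g) :
    ∫⁻ x, g x ∂pushWeight P e L = ∫⁻ y, L y * g (e y) ∂P := by
  have he' : AEMeasurable e (P.withDensity L) := he.mono_ac (withDensity_absolutelyContinuous _ _)
  rw [pushWeight, lintegral_map' hg.aemeasurable he',
    lintegral_withDensity_eq_lintegral_mul₀ (g := fun y => g (e y)) hL (hg.comp_aemeasurable he)]
  rfl

theorem pushWeight_apply (he : AEMeasurable e P) {L : Y → ℝ≥0∞} (hL : AEMeasurable L P)
    {B : Set X} (hB : MeasurableSet B) :
    pushWeight P e L B = ∫⁻ y, L y * B.indicator 1 (e y) ∂P := by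
  rw [← lintegral_pushWeight he hL (measurable_one.indicator hB), lintegral_indicator_one hB]

theorem isFiniteMeasure_pushWeight {L : Y → ℝ≥0∞} (hL : ∫⁻ y, L y ∂P ≠ ∞) :
    IsFiniteMeasure (pushWeight P e L) := by
  have := isFiniteMeasure_withDensity hL
  unfold pushWeight
  infer_instance

theorem isFiniteMeasure_pushWeight_ofReal {w : Y → ℝ} (hw : Integrable w P) :
    IsFiniteMeasure (pushWeight P e fun y => ENNReal.ofReal (w y)) := by
  have := isFiniteMeasure_withDensity_ofReal (μ := P) hw.2
  unfold pushWeight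
  infer_instance

theorem integrable_density_mul [SigmaFinite m] {μ : Measure X} [IsFiniteMeasure μ] (hμ : μ ≪ m)
    {φ : X → ℝ} (hφ : Measurable φ) {C : ℝ} (hC : ∀ x, |φ x| ≤ C) :
    Integrable (fun x => density μ m x * φ x) m :=
  (integrable_toReal_rnDeriv_mul_iff hμ).2
    (Integrable.of_bound hφ.aestronglyMeasurable C (Eventually.of_forall hC))

theorem integral_density_pushWeight_mul [SigmaFinite m] (he : AEMeasurable e P) {w : Y → ℝ}
    (hw : Integrable w P) (hac : pushWeight P e (fun y => ENNReal.ofReal (w y)) ≪ m)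
    {φ : X → ℝ} (hφ : Measurable φ) :
    ∫ x, density (pushWeight P e fun y => ENNReal.ofReal (w y)) m x * φ x ∂m =
      ∫ y, max (w y) 0 * φ (e y) ∂P := by
  have he' : AEMeasurable e (P.withDensity fun y => ENNReal.ofReal (w y)) :=
    he.mono_ac (withDensity_absolutelyContinuous _ _)
  have := isFiniteMeasure_pushWeight_ofReal (e := e) hw
  unfold density
  rw [integral_toReal_rnDeriv_mul hac, pushWeight, integral_map he' hφ.aestronglyMeasurable,
    integral_withDensity_eq_integral_toReal_smul₀ hw.1.aemeasurable.ennreal_ofReal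
      (Eventually.of_forall fun _ => ENNReal.ofReal_lt_top)]
  simp only [ENNReal.toReal_ofReal', smul_eq_mul]

theorem integrable_signedDensity_mul [SigmaFinite m] {w : Y → ℝ} (hw : Integrable w P)
    (hac : pushWeight P e (fun y => ENNReal.ofReal (w y)) ≪ m)
    (hac' : pushWeight P e (fun y => ENNReal.ofReal (-w y)) ≪ m)
    {φ : X → ℝ} (hφ : Measurable φ) {C : ℝ} (hC : ∀ x, |φ x| ≤ C) :
    Integrable (fun x => signedDensity P e m w x * φ x) m := by
  have hwn : Integrable (fun y => -w y) P := hw.neg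
  have h1 := isFiniteMeasure_pushWeight_ofReal (e := e) hw
  have h2 := isFiniteMeasure_pushWeight_ofReal (e := e) hwn
  simp only [signedDensity, sub_mul]
  exact (integrable_density_mul hac hφ hC).sub (integrable_density_mul hac' hφ hC)

/-- The change of variables formula characterising the signed density. -/
theorem integral_signedDensity_mul [SigmaFinite m] (he : AEMeasurable e P) {w : Y → ℝ}
    (hw : Integrable w P) (hac : pushWeight P e (fun y => ENNReal.ofReal (w y)) ≪ m)
    (hac' : pushWeight P e (fun y => ENNReal.ofReal (-w y)) ≪ m)
    {φ : X → ℝ} (hφ : Measurable φ) {C : ℝ} (hC : ∀ x, |φ x| ≤ C) :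
    ∫ x, signedDensity P e m w x * φ x ∂m = ∫ y, w y * φ (e y) ∂P := by
  have hwn : Integrable (fun y => -w y) P := hw.neg
  have h1 := isFiniteMeasure_pushWeight_ofReal (e := e) hw
  have h2 := isFiniteMeasure_pushWeight_ofReal (e := e) hwn
  have hφe : AEStronglyMeasurable (fun y => φ (e y)) P :=
    (hφ.comp_aemeasurable he).aestronglyMeasurable
  have hpos : Integrable (fun y => max (w y) 0 * φ (e y)) P :=
    hw.pos_part.mul_bdd hφe (Eventually.of_forall fun y => hC (e y))
  have hneg : Integrable (fun y => max (-w y) 0 * φ (e y)) P :=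
    hw.neg_part.mul_bdd hφe (Eventually.of_forall fun y => hC (e y))
  simp only [signedDensity, sub_mul]
  rw [integral_sub (integrable_density_mul hac hφ hC) (integrable_density_mul hac' hφ hC),
    integral_density_pushWeight_mul he hw hac hφ,
    integral_density_pushWeight_mul he hwn hac' hφ, ← integral_sub hpos hneg]
  refine integral_congr_ae (Eventually.of_forall fun y => ?_)
  dsimp only
  rw [← sub_mul, max_zero_sub_eq_self]

theorem pushWeight_add_le (he : AEMeasurable e P) {w : Y → ℝ} (hw : AEMeasurable w P)
    {L : Y → ℝ≥0∞} (hL : AEMeasurable L P) {c : X → ℝ≥0∞} (hc : Measurable c)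
    (hle : ∀ y, ENNReal.ofReal |w y| ≤ c (e y) * L y) {B : Set X} (hB : MeasurableSet B) :
    pushWeight P e (fun y => ENNReal.ofReal (w y)) B +
      pushWeight P e (fun y => ENNReal.ofReal (-w y)) B ≤ ∫⁻ x in B, c x ∂pushWeight P e L := by
  have hwn : AEMeasurable (fun y => -w y) P := hw.neg
  have hm : AEMeasurable (fun y => ENNReal.ofReal (w y) * B.indicator 1 (e y)) P :=
    hw.ennreal_ofReal.mul ((measurable_one.indicator hB).comp_aemeasurable he)
  rw [pushWeight_apply he hw.ennreal_ofReal hB, pushWeight_apply he hwn.ennreal_ofReal hB,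
    ← lintegral_indicator hB, lintegral_pushWeight he hL (hc.indicator hB),
    ← lintegral_add_left' hm]
  refine lintegral_mono fun y => ?_
  by_cases hy : e y ∈ B
  · simp only [indicator_of_mem hy, Pi.one_apply, mul_one]
    refine le_trans (le_of_eq ?_) ((hle y).trans_eq (mul_comm _ _))
    rcases le_total 0 (w y) with h | h
    · rw [abs_of_nonneg h, ENNReal.ofReal_of_nonpos (neg_nonpos.2 h), add_zero]
    · rw [abs_of_nonpos h, ENNReal.ofReal_of_nonpos h, zero_add]
  · simp [indicator_of_notMem hy]

theorem pushWeight_absolutelyContinuous (he : AEMeasurable e P) {w : Y → ℝ}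
    (hw : AEMeasurable w P) {L : Y → ℝ≥0∞} (hL : AEMeasurable L P) {c : X → ℝ≥0∞}
    (hc : Measurable c) (hle : ∀ y, ENNReal.ofReal |w y| ≤ c (e y) * L y)
    (hν : pushWeight P e L ≪ m) :
    pushWeight P e (fun y => ENNReal.ofReal (w y)) ≪ m := by
  refine Measure.AbsolutelyContinuous.mk fun B hB h0 => le_antisymm ?_ bot_le
  refine (le_self_add.trans (pushWeight_add_le he hw hL hc hle hB)).trans ?_
  rw [setLIntegral_measure_zero _ _ (hν h0)]

/-- A bound `|w| ≤ (c ∘ e) L` on the weight bounds its signed density by `c` times the density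
of `e_#(L P)`. -/
theorem abs_signedDensity_le [IsFiniteMeasure m] (he : AEMeasurable e P) {w : Y → ℝ}
    (hw : Integrable w P) {L : Y → ℝ≥0∞} (hL : AEMeasurable L P) (hLfin : ∫⁻ y, L y ∂P ≠ ∞)
    {c : X → ℝ≥0∞} (hc : Measurable c) (hcfin : ∀ x, c x < ∞)
    (hle : ∀ y, ENNReal.ofReal |w y| ≤ c (e y) * L y) (hν : pushWeight P e L ≪ m) :
    ∀ᵐ x ∂m, |signedDensity P e m w x| ≤ density (pushWeight P e L) m x * (c x).toReal := by
  have := isFiniteMeasure_pushWeight (e := e) hLfin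
  have hwn : Integrable (fun y => -w y) P := hw.neg
  have h1 := isFiniteMeasure_pushWeight_ofReal (e := e) hw
  have h2 := isFiniteMeasure_pushWeight_ofReal (e := e) hwn
  have hac := pushWeight_absolutelyContinuous he hw.1.aemeasurable hL hc hle hν
  have hac' := pushWeight_absolutelyContinuous he hwn.1.aemeasurable hL hc
    (fun y => by rw [abs_neg]; exact hle y) hν
  have key : (fun x => (pushWeight P e fun y => ENNReal.ofReal (w y)).rnDeriv m x +
      (pushWeight P e fun y => ENNReal.ofReal (-w y)).rnDeriv m x) ≤ᵐ[m]
      fun x => (pushWeight P e L).rnDeriv m x * c x := by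
    refine ae_le_of_forall_setLIntegral_le_of_sigmaFinite
      ((Measure.measurable_rnDeriv _ _).add (Measure.measurable_rnDeriv _ _)) fun B hB _ => ?_
    rw [lintegral_add_left (Measure.measurable_rnDeriv _ _), Measure.setLIntegral_rnDeriv hac,
      Measure.setLIntegral_rnDeriv hac', setLIntegral_rnDeriv_mul hν hc.aemeasurable hB]
    exact pushWeight_add_le he hw.1.aemeasurable hL hc hle hB
  filter_upwards [key, (pushWeight P e L).rnDeriv_lt_top m,
    (pushWeight P e fun y => ENNReal.ofReal (w y)).rnDeriv_lt_top m,
    (pushWeight P e fun y => ENNReal.ofReal (-w y)).rnDeriv_lt_top m] with x hx hL1 hp1 hn1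
  have h3 := ENNReal.toReal_mono (ENNReal.mul_ne_top hL1.ne (hcfin x).ne) hx
  rw [ENNReal.toReal_add hp1.ne hn1.ne, ENNReal.toReal_mul] at h3
  refine le_trans ?_ h3
  have hp0 := density_nonneg (pushWeight P e fun y => ENNReal.ofReal (w y)) m x
  have hn0 := density_nonneg (pushWeight P e fun y => ENNReal.ofReal (-w y)) m x
  unfold density at hp0 hn0
  unfold signedDensity density
  rw [abs_le]
  constructor <;> linarith

/-- A signed density is determined by the integrals of its weight over preimages. -/
theorem ae_eq_signedDensity [SigmaFinite m] (he : AEMeasurable e P) {w : Y → ℝ}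
    (hw : Integrable w P) (hac : pushWeight P e (fun y => ENNReal.ofReal (w y)) ≪ m)
    (hac' : pushWeight P e (fun y => ENNReal.ofReal (-w y)) ≪ m) {u : X → ℝ}
    (hu : Integrable u m) (h : ∀ B, MeasurableSet B →
      ∫ x, u x * B.indicator 1 x ∂m = ∫ y, w y * B.indicator 1 (e y) ∂P) :
    signedDensity P e m w =ᵐ[m] u := by
  have hi : Integrable (signedDensity P e m w) m := by
    simpa using integrable_signedDensity_mul hw hac hac' (measurable_const (a := (1 : ℝ)))
      (C := 1) (fun _ => by simp)
  have hset : ∀ (v : X → ℝ) (B : Set X), MeasurableSet B →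
      ∫ x in B, v x ∂m = ∫ x, v x * B.indicator 1 x ∂m := fun v B hB => by
    rw [← integral_indicator hB]
    refine integral_congr_ae (Eventually.of_forall fun x => ?_)
    by_cases hx : x ∈ B <;> simp [hx]
  refine hi.ae_eq_of_forall_setIntegral_eq _ _ hu fun B hB _ => ?_
  rw [hset _ B hB, hset _ B hB, h B hB]
  exact integral_signedDensity_mul he hw hac hac' (measurable_one.indicator hB)
    (abs_indicator_one_le B)

end Push

/-! ### Infima in `L⁰` -/

section Infimum

variable {X : Type*} [MeasurableSpace X] {m : Measure X}

/-- A family of nonnegative elements of `L⁰(m)` that is closed under binary infima and contains an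
integrable element has an infimum: minimise the integral over the members below the given one. -/
theorem exists_isGLB_of_inf_mem {S : Set (X →ₘ[m] ℝ)} (h0 : ∀ g ∈ S, 0 ≤ g)
    (hinf : ∀ g ∈ S, ∀ h ∈ S, g ⊓ h ∈ S) {g₀ : X →ₘ[m] ℝ} (hg₀ : g₀ ∈ S)
    (hint : Integrable g₀ m) : ∃ g, IsGLB S g := by
  have hnn : ∀ g ∈ S, ∀ᵐ x ∂m, 0 ≤ g x := fun g hg => by
    filter_upwards [AEEqFun.coeFn_le.2 (h0 g hg), AEEqFun.coeFn_zero (μ := m) (β := ℝ)]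
      with x hx hz
    rwa [hz] at hx
  have hi : ∀ g ∈ S, g ≤ g₀ → Integrable g m := fun g hg hle =>
    hint.mono' g.aestronglyMeasurable (by
      filter_upwards [hnn g hg, AEEqFun.coeFn_le.2 hle] with x h1 h2
      rwa [Real.norm_eq_abs, abs_of_nonneg h1])
  let T : Set ℝ := (fun g : X →ₘ[m] ℝ => ∫ x, g x ∂m) '' {g | g ∈ S ∧ g ≤ g₀}
  have hTne : T.Nonempty := ⟨_, g₀, ⟨hg₀, le_rfl⟩, rfl⟩
  have hTb : BddBelow T := ⟨0, by
    rintro _ ⟨g, hg, rfl⟩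
    exact integral_nonneg_of_ae (hnn g hg.1)⟩
  obtain ⟨v, -, hv, hvT⟩ := exists_seq_tendsto_sInf hTne hTb
  choose k hk hkv using hvT
  -- The decreasing minimising sequence of the partial infima.
  let G : ℕ → X →ₘ[m] ℝ := fun n => Nat.rec g₀ (fun i h => h ⊓ k i) n
  have hGsucc : ∀ n, G (n + 1) = G n ⊓ k n := fun n => rfl
  have hGS : ∀ n, G n ∈ S := fun n => by
    induction n with
    | zero => exact hg₀
    | succ n ih => exact hinf _ ih _ (hk n).1
  have hGanti : Antitone G := antitone_nat_of_succ_le fun n => by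
    rw [hGsucc]
    exact inf_le_left
  have hGle : ∀ n, G n ≤ g₀ := fun n => hGanti (Nat.zero_le n)
  have hGlim : Tendsto (fun n => ∫ x, G n x ∂m) atTop (𝓝 (sInf T)) := by
    refine (tendsto_add_atTop_iff_nat 1).1 (tendsto_of_tendsto_of_tendsto_of_le_of_le
      tendsto_const_nhds hv
      (fun n => csInf_le hTb ⟨G (n + 1), ⟨hGS (n + 1), hGle (n + 1)⟩, rfl⟩) fun n => ?_)
    rw [← hkv]
    refine integral_mono_ae (hi _ (hGS (n + 1)) (hGle (n + 1))) (hi _ (hk n).1 (hk n).2) ?_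
    exact AEEqFun.coeFn_le.2 (by rw [hGsucc]; exact inf_le_right)
  have hanti : ∀ᵐ x ∂m, Antitone fun n => G n x := by
    filter_upwards [ae_all_iff.2 fun n => AEEqFun.coeFn_le.2 (hGanti (Nat.le_succ n))] with x hx
    exact antitone_nat_of_succ_le hx
  have hpos : ∀ᵐ x ∂m, ∀ n, 0 ≤ G n x := ae_all_iff.2 fun n => hnn _ (hGS n)
  let g' : X → ℝ := fun x => ⨅ n, G n x
  have hg'm : AEStronglyMeasurable g' m :=
    (Measurable.iInf fun n => (G n).measurable).aestronglyMeasurable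
  have hlim : ∀ᵐ x ∂m, Tendsto (fun n => G n x) atTop (𝓝 (g' x)) := by
    filter_upwards [hanti, hpos] with x hx hp
    exact tendsto_atTop_ciInf hx ⟨0, by rintro _ ⟨n, rfl⟩; exact hp n⟩
  have hgle : ∀ n, ∀ᵐ x ∂m, g' x ≤ G n x := fun n => by
    filter_upwards [hanti, hlim] with x hx hl
    exact hx.le_of_tendsto hl n
  refine ⟨AEEqFun.mk g' hg'm, fun h hh => ?_, fun h hh => ?_⟩
  · -- Otherwise the infimum with `h` would have a smaller integral.
    have hmem : ∀ n, G n ⊓ h ∈ S := fun n => hinf _ (hGS n) _ hh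
    have hle : ∀ n, G n ⊓ h ≤ g₀ := fun n => inf_le_left.trans (hGle n)
    have hcoe : ∀ᵐ x ∂m, ∀ n, (G n ⊓ h : X →ₘ[m] ℝ) x = min (G n x) (h x) :=
      ae_all_iff.2 fun n => AEEqFun.coeFn_inf _ _
    have hdom : ∀ n, ∀ᵐ x ∂m, ‖(G n ⊓ h : X →ₘ[m] ℝ) x‖ ≤ g₀ x := fun n => by
      filter_upwards [hnn _ (hmem n), AEEqFun.coeFn_le.2 (hle n)] with x h1 h2
      rwa [Real.norm_eq_abs, abs_of_nonneg h1]
    have hl1 : Tendsto (fun n => ∫ x, (G n ⊓ h : X →ₘ[m] ℝ) x ∂m) atTop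
        (𝓝 (∫ x, min (g' x) (h x) ∂m)) := by
      refine tendsto_integral_of_dominated_convergence g₀
        (fun n => (G n ⊓ h).aestronglyMeasurable) hint hdom ?_
      filter_upwards [hcoe, hlim] with x hx hl
      simp only [hx]
      exact hl.min tendsto_const_nhds
    have hdomG : ∀ n, ∀ᵐ x ∂m, ‖G n x‖ ≤ g₀ x := fun n => by
      filter_upwards [hnn _ (hGS n), AEEqFun.coeFn_le.2 (hGle n)] with x h1 h2
      rwa [Real.norm_eq_abs, abs_of_nonneg h1]
    have hl2 : Tendsto (fun n => ∫ x, G n x ∂m) atTop (𝓝 (∫ x, g' x ∂m)) :=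
      tendsto_integral_of_dominated_convergence g₀
        (fun n => (G n).aestronglyMeasurable) hint hdomG hlim
    have hge : ∫ x, g' x ∂m ≤ ∫ x, min (g' x) (h x) ∂m := by
      rw [tendsto_nhds_unique hl2 hGlim]
      exact ge_of_tendsto' hl1 fun n => csInf_le hTb ⟨_, ⟨hmem n, hle n⟩, rfl⟩
    have hg'0 : ∀ᵐ x ∂m, 0 ≤ g' x := by
      filter_upwards [hlim, hpos] with x hl hp
      exact ge_of_tendsto' hl hp
    have hg'i : Integrable g' m := hint.mono' hg'm (by
      filter_upwards [hg'0, hgle 0] with x h1 h2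
      rwa [Real.norm_eq_abs, abs_of_nonneg h1])
    have hmi : Integrable (fun x => min (g' x) (h x)) m :=
      hg'i.mono' (hg'm.inf h.aestronglyMeasurable) (by
        filter_upwards [hg'0, hnn h hh] with x h1 h2
        rw [Real.norm_eq_abs, abs_of_nonneg (le_min h1 h2)]
        exact min_le_left _ _)
    have heq : (fun x => min (g' x) (h x)) =ᵐ[m] g' := by
      refine (integral_eq_iff_of_ae_le hmi hg'i (Eventually.of_forall fun x => min_le_left _ _)).1
        (le_antisymm (integral_mono hmi hg'i fun x => min_le_left _ _) hge)
    rw [← AEEqFun.coeFn_le]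
    filter_upwards [AEEqFun.coeFn_mk g' hg'm, heq] with x h1 h2
    rw [h1, ← h2]
    exact min_le_right _ _
  · have hle : ∀ᵐ x ∂m, ∀ n, h x ≤ G n x :=
      ae_all_iff.2 fun n => AEEqFun.coeFn_le.2 (hh (hGS n))
    rw [← AEEqFun.coeFn_le]
    filter_upwards [AEEqFun.coeFn_mk g' hg'm, hle, hlim] with x h1 h2 h3
    rw [h1]
    exact ge_of_tendsto' h3 h2

end Infimum

/-! ### The derivation induced by a test plan -/

section PlanDerivation

theorem abs_indicator_mul_le {X : Type*} [TopologicalSpace X] (f : X →ᵇ ℝ) (B : Set X) (x : X) :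
    |f x * B.indicator (1 : X → ℝ) x| ≤ ‖f‖ := by
  rw [abs_mul]
  calc |f x| * |B.indicator (1 : X → ℝ) x| ≤ ‖f‖ * 1 :=
        mul_le_mul (f.norm_coe_le_norm x) (abs_indicator_one_le B x) (abs_nonneg _) (norm_nonneg _)
    _ = ‖f‖ := mul_one _

theorem measurable_planDer {X : Type*} [TopologicalSpace X] [MeasurableSpace X] {d : ExtDist X}
    {m : Measure X} {π : Measure (RectArc d)} (f : X → ℝ) : Measurable (planDer d m π f) :=
  (measurable_density _ _).sub (measurable_density _ _)

variable {X : Type*} [TopologicalSpace X] [MeasurableSpace X] [BorelSpace X] {d : ExtDist X}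
  {m : Measure X} {π : Measure (RectArc d)}

theorem IsDynamicPlan.aemeasurable_evalMap (hd : IsEMTSpace d) (hπ : IsDynamicPlan d π) :
    AEMeasurable (evalMap d) (planHat π) :=
  hπ.aemeasurable_evalMap_comp hd continuous_id

variable (π) in
/-- The push-forward under the evaluation map of the length times `π ⊗ 𝓛¹`. -/
noncomputable def arcLengthMeasure : Measure X :=
  pushWeight (planHat π) (evalMap d) fun p => p.1.len

/-- The barycenter of a dynamic plan can only be the push-forward of `ℓ π̂` under the evaluation
map; in particular it is unique. -/
theorem IsBarycenter.eq_arcLengthMeasure (hd : IsEMTSpace d) (hπ : IsDynamicPlan d π)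
    {μ : Measure X} (hμ : IsBarycenter d π μ) : μ = arcLengthMeasure π := by
  have := hπ.finite
  have := hμ.finite
  have : IsFiniteMeasure (arcLengthMeasure π) :=
    isFiniteMeasure_pushWeight (hπ.lintegral_len_planHat hd)
  have he := hπ.aemeasurable_evalMap hd
  refine Measure.ext fun B hB => ?_
  have hBm : Measurable (B.indicator (1 : X → ℝ)) := measurable_one.indicator hB
  have h1 := hμ.integral_eq _ hBm ⟨1, abs_indicator_one_le B⟩
  have hint : Integrable (fun p : RectArc d × I =>
      p.1.len.toReal * B.indicator (1 : X → ℝ) (evalMap d p)) (planHat π) :=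
    (hπ.integrable_len hd).mul_bdd (hBm.comp_aemeasurable he).aestronglyMeasurable
      (Eventually.of_forall fun p => abs_indicator_one_le B _)
  have h2 : ∫ a, a.pathIntegral (B.indicator 1) ∂π = ∫ p : RectArc d × I,
      p.1.len.toReal * B.indicator (1 : X → ℝ) (evalMap d p) ∂planHat π := by
    unfold planHat at hint ⊢
    rw [integral_prod _ hint]
    refine integral_congr_ae (Eventually.of_forall fun a => ?_)
    exact (integral_const_mul _ _).symm
  have h3 : ∫ p : RectArc d × I, p.1.len.toReal * B.indicator (1 : X → ℝ) (evalMap d p)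
      ∂planHat π = (arcLengthMeasure π B).toReal := by
    rw [arcLengthMeasure, pushWeight_apply he (measurable_len_fst hd).aemeasurable hB,
      integral_eq_lintegral_of_nonneg_ae _ hint.1]
    · congr 1
      refine lintegral_congr fun p => ?_
      by_cases hp : evalMap d p ∈ B
      · simp [hp, ENNReal.ofReal_toReal p.1.len_ne_top]
      · simp [hp]
    · refine Eventually.of_forall fun p => mul_nonneg ENNReal.toReal_nonneg ?_
      exact indicator_nonneg (fun _ _ => zero_le_one) _
  rw [h2, h3, integral_indicator_one hB] at h1
  exact (ENNReal.toReal_eq_toReal_iff' (measure_ne_top _ _) (measure_ne_top _ _)).1 h1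

theorem IsDynamicPlan.integrable_arcDeriv (hd : IsEMTSpace d) (hπ : IsDynamicPlan d π)
    (f : LipB d) : Integrable (arcDeriv d (f : X →ᵇ ℝ)) (planHat π) := by
  obtain ⟨K, hK⟩ := exists_asympSlope_toReal_le f
  refine ((hπ.integrable_len hd).const_mul K).mono'
    (hπ.aemeasurable_arcDeriv hd f).aestronglyMeasurable (Eventually.of_forall fun p => ?_)
  exact (hd.abs_arcDeriv_le f p).trans
    (mul_le_mul_of_nonneg_right (hK _) ENNReal.toReal_nonneg)

theorem measurable_asympSlope (f : X → ℝ) : Measurable (asympSlope d f) :=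
  (upperSemicontinuous_asympSlope f).measurable

theorem IsDynamicPlan.pushPos_absolutelyContinuous (hd : IsEMTSpace d) (hπ : IsDynamicPlan d π)
    (hν : arcLengthMeasure π ≪ m) (f : LipB d) : pushPos d π (f : X →ᵇ ℝ) ≪ m :=
  pushWeight_absolutelyContinuous (hπ.aemeasurable_evalMap hd) (hπ.aemeasurable_arcDeriv hd f)
    (measurable_len_fst hd).aemeasurable (measurable_asympSlope _) (ofReal_abs_arcDeriv_le hd f) hν

theorem IsDynamicPlan.pushNeg_absolutelyContinuous (hd : IsEMTSpace d) (hπ : IsDynamicPlan d π)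
    (hν : arcLengthMeasure π ≪ m) (f : LipB d) : pushNeg d π (f : X →ᵇ ℝ) ≪ m :=
  pushWeight_absolutelyContinuous (w := fun p => -arcDeriv d (f : X →ᵇ ℝ) p)
    (hπ.aemeasurable_evalMap hd) (hπ.aemeasurable_arcDeriv hd f).neg
    (measurable_len_fst hd).aemeasurable (measurable_asympSlope _)
    (fun p => by rw [abs_neg]; exact ofReal_abs_arcDeriv_le hd f p) hν

theorem IsDynamicPlan.abs_planDer_le [IsFiniteMeasure m] (hd : IsEMTSpace d)
    (hπ : IsDynamicPlan d π) (hν : arcLengthMeasure π ≪ m) (f : LipB d) :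
    ∀ᵐ x ∂m, |planDer d m π (f : X →ᵇ ℝ) x| ≤
      density (arcLengthMeasure π) m x * (asympSlope d (f : X →ᵇ ℝ) x).toReal :=
  abs_signedDensity_le (hπ.aemeasurable_evalMap hd) (hπ.integrable_arcDeriv hd f)
    (measurable_len_fst hd).aemeasurable (hπ.lintegral_len_planHat hd) (measurable_asympSlope _)
    (asympSlope_lt_top f) (ofReal_abs_arcDeriv_le hd f) hν

theorem IsDynamicPlan.memLp_planDer [IsFiniteMeasure m] (hd : IsEMTSpace d)
    (hπ : IsDynamicPlan d π) (hν : arcLengthMeasure π ≪ m) {q : ℝ≥0∞}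
    (hq : MemLp (density (arcLengthMeasure π) m) q m) (f : LipB d) :
    MemLp (planDer d m π (f : X →ᵇ ℝ)) q m := by
  obtain ⟨K, hK⟩ := exists_asympSlope_toReal_le f
  refine hq.of_le_mul (c := K) (measurable_planDer _).aestronglyMeasurable ?_
  filter_upwards [hπ.abs_planDer_le hd hν f] with x hx
  rw [Real.norm_eq_abs, Real.norm_of_nonneg (density_nonneg _ _ _), mul_comm]
  exact hx.trans (mul_le_mul_of_nonneg_left (hK x) (density_nonneg _ _ _))

theorem IsDynamicPlan.integrable_planDer_mul [IsFiniteMeasure m] (hd : IsEMTSpace d)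
    (hπ : IsDynamicPlan d π) (hν : arcLengthMeasure π ≪ m) (f : LipB d) {φ : X → ℝ}
    (hφ : Measurable φ) {C : ℝ} (hC : ∀ x, |φ x| ≤ C) :
    Integrable (fun x => planDer d m π (f : X →ᵇ ℝ) x * φ x) m :=
  integrable_signedDensity_mul (hπ.integrable_arcDeriv hd f)
    (hπ.pushPos_absolutelyContinuous hd hν f) (hπ.pushNeg_absolutelyContinuous hd hν f) hφ hC

theorem IsDynamicPlan.integrable_planDer [IsFiniteMeasure m] (hd : IsEMTSpace d)
    (hπ : IsDynamicPlan d π) (hν : arcLengthMeasure π ≪ m) (f : LipB d) :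
    Integrable (planDer d m π (f : X →ᵇ ℝ)) m := by
  simpa using hπ.integrable_planDer_mul hd hν f (measurable_const (a := (1 : ℝ))) (C := 1)
    (fun _ => by simp)

theorem IsDynamicPlan.integral_planDer_mul [IsFiniteMeasure m] (hd : IsEMTSpace d)
    (hπ : IsDynamicPlan d π) (hν : arcLengthMeasure π ≪ m) (f : LipB d) {φ : X → ℝ}
    (hφ : Measurable φ) {C : ℝ} (hC : ∀ x, |φ x| ≤ C) :
    ∫ x, planDer d m π (f : X →ᵇ ℝ) x * φ x ∂m =
      ∫ p, arcDeriv d (f : X →ᵇ ℝ) p * φ (evalMap d p) ∂planHat π :=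
  integral_signedDensity_mul (hπ.aemeasurable_evalMap hd) (hπ.integrable_arcDeriv hd f)
    (hπ.pushPos_absolutelyContinuous hd hν f) (hπ.pushNeg_absolutelyContinuous hd hν f) hφ hC

/-- If the derivative of `f` along almost every arc is the combination `φ₁ D_g + φ₂ D_h`, then
`b_π(f) = φ₁ b_π(g) + φ₂ b_π(h)`. Linearity and the Leibniz rule are special cases. -/
theorem IsDynamicPlan.planDer_eq_of_arcDeriv_eq [IsFiniteMeasure m] (hd : IsEMTSpace d)
    (hπ : IsDynamicPlan d π) (hν : arcLengthMeasure π ≪ m) (f g h : LipB d) (φ₁ φ₂ : X →ᵇ ℝ)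
    (hD : ∀ᵐ p ∂planHat π, arcDeriv d (f : X →ᵇ ℝ) p =
      φ₁ (evalMap d p) * arcDeriv d (g : X →ᵇ ℝ) p +
        φ₂ (evalMap d p) * arcDeriv d (h : X →ᵇ ℝ) p) :
    planDer d m π (f : X →ᵇ ℝ) =ᵐ[m] fun x =>
      φ₁ x * planDer d m π (g : X →ᵇ ℝ) x + φ₂ x * planDer d m π (h : X →ᵇ ℝ) x := by
  have he := hπ.aemeasurable_evalMap hd
  have hi : ∀ (k : LipB d) (φ : X →ᵇ ℝ),
      Integrable (fun x => φ x * planDer d m π (k : X →ᵇ ℝ) x) m := fun k φ => by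
    simpa only [mul_comm] using hπ.integrable_planDer_mul hd hν k φ.continuous.measurable
      (fun x => φ.norm_coe_le_norm x)
  refine ae_eq_signedDensity he (hπ.integrable_arcDeriv hd f)
    (hπ.pushPos_absolutelyContinuous hd hν f) (hπ.pushNeg_absolutelyContinuous hd hν f)
    ((hi g φ₁).add (hi h φ₂)) fun B hB => ?_
  have hBm : Measurable (B.indicator (1 : X → ℝ)) := measurable_one.indicator hB
  have hm : ∀ φ : X →ᵇ ℝ, Measurable fun x => φ x * B.indicator (1 : X → ℝ) x := fun φ =>
    φ.continuous.measurable.mul hBm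
  have hsplit : ∫ x, (φ₁ x * planDer d m π (g : X →ᵇ ℝ) x + φ₂ x * planDer d m π (h : X →ᵇ ℝ) x) *
      B.indicator 1 x ∂m = ∫ x, (planDer d m π (g : X →ᵇ ℝ) x * (φ₁ x * B.indicator 1 x) +
        planDer d m π (h : X →ᵇ ℝ) x * (φ₂ x * B.indicator 1 x)) ∂m :=
    integral_congr_ae (Eventually.of_forall fun x => by dsimp only; ring)
  have hie : ∀ (k : LipB d) (φ : X →ᵇ ℝ), Integrable (fun p => arcDeriv d (k : X →ᵇ ℝ) p *
      (φ (evalMap d p) * B.indicator (1 : X → ℝ) (evalMap d p))) (planHat π) := fun k φ =>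
    (hπ.integrable_arcDeriv hd k).mul_bdd ((hm φ).comp_aemeasurable he).aestronglyMeasurable
      (Eventually.of_forall fun p => abs_indicator_mul_le φ B (evalMap d p))
  rw [hsplit, integral_add
    (hπ.integrable_planDer_mul hd hν g (hm φ₁) (abs_indicator_mul_le φ₁ B))
    (hπ.integrable_planDer_mul hd hν h (hm φ₂) (abs_indicator_mul_le φ₂ B)),
    hπ.integral_planDer_mul hd hν g (hm φ₁) (abs_indicator_mul_le φ₁ B),
    hπ.integral_planDer_mul hd hν h (hm φ₂) (abs_indicator_mul_le φ₂ B),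
    ← integral_add (hie g φ₁) (hie h φ₂)]
  refine integral_congr_ae (hD.mono fun p hp => ?_)
  dsimp only
  rw [hp]
  ring

/-- The derivation `b_π` of a dynamic plan with absolutely continuous barycenter. -/
noncomputable def planDerivation [IsFiniteMeasure m] (hd : IsEMTSpace d) (hπ : IsDynamicPlan d π)
    (hν : arcLengthMeasure π ≪ m) : LipDerivation d m where
  toFun f := AEEqFun.mk (planDer d m π (f : X →ᵇ ℝ)) (measurable_planDer _).aestronglyMeasurable
  map_add' f g := by
    rw [AEEqFun.mk_add_mk, AEEqFun.mk_eq_mk]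
    refine (hπ.planDer_eq_of_arcDeriv_eq hd hν (f + g) f g 1 1 ?_).trans
      (Eventually.of_forall fun x => by simp)
    exact (hπ.arcDeriv_add hd f g).mono fun p hp => by simpa using hp
  map_smul' c f := by
    have h := hπ.planDer_eq_of_arcDeriv_eq hd hν (c • f) f f
      (BoundedContinuousFunction.const X c) 0
      ((hπ.arcDeriv_smul hd c f).mono fun p hp => by simpa using hp)
    have hm := (measurable_planDer (m := m) (π := π) (f : X →ᵇ ℝ)).aestronglyMeasurable (μ := m)
    refine AEEqFun.ext ?_
    filter_upwards [h, AEEqFun.coeFn_mk _ hm, AEEqFun.coeFn_smul c (AEEqFun.mk _ hm),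
      AEEqFun.coeFn_mk _ (measurable_planDer (m := m) (π := π)
        ((c • f : LipB d) : X →ᵇ ℝ)).aestronglyMeasurable] with x h1 h2 h3 h4
    rw [h4, RingHom.id_apply, h3, Pi.smul_apply, h2, h1]
    simp
  leibniz f g := by
    rw [toL0, toL0, AEEqFun.mk_mul_mk, AEEqFun.mk_mul_mk, AEEqFun.mk_add_mk, AEEqFun.mk_eq_mk]
    exact hπ.planDer_eq_of_arcDeriv_eq hd hν (f * g) g f f g (hπ.arcDeriv_mul hd f g)

theorem planDerivation_apply [IsFiniteMeasure m] (hd : IsEMTSpace d) (hπ : IsDynamicPlan d π)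
    (hν : arcLengthMeasure π ≪ m) (f : LipB d) :
    (planDerivation hd hπ hν).toFun f =ᵐ[m] planDer d m π (f : X →ᵇ ℝ) :=
  AEEqFun.coeFn_mk _ _

theorem LipDerivation.inf_mem_bounds (b : LipDerivation d m) {g h : X →ₘ[m] ℝ}
    (hg : g ∈ b.bounds) (hh : h ∈ b.bounds) : g ⊓ h ∈ b.bounds := by
  refine ⟨le_inf hg.1 hh.1, fun f => ?_⟩
  filter_upwards [hg.2 f, hh.2 f, AEEqFun.coeFn_inf g h] with x h1 h2 h3
  rw [h3]
  rcases min_choice (g x) (h x) with h4 | h4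
  · exact h1.trans_eq (by rw [h4])
  · exact h2.trans_eq (by rw [h4])

/-- The density of the barycenter is a bound of `b_π`. -/
theorem mk_density_mem_bounds [IsFiniteMeasure m] (hd : IsEMTSpace d) (hπ : IsDynamicPlan d π)
    (hν : arcLengthMeasure π ≪ m) :
    AEEqFun.mk (density (arcLengthMeasure π) m) (measurable_density _ _).aestronglyMeasurable ∈
      (planDerivation hd hπ hν).bounds := by
  constructor
  · rw [← AEEqFun.coeFn_le]
    filter_upwards [AEEqFun.coeFn_zero (μ := m) (β := ℝ), AEEqFun.coeFn_mk
      (density (arcLengthMeasure π) m) (measurable_density _ _).aestronglyMeasurable] with x h1 h2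
    rw [h1, h2]
    exact density_nonneg _ _ _
  · intro f
    filter_upwards [planDerivation_apply hd hπ hν f, hπ.abs_planDer_le hd hν f, AEEqFun.coeFn_mk
      (density (arcLengthMeasure π) m) (measurable_density _ _).aestronglyMeasurable]
      with x h1 h2 h3
    rw [h1, h3]
    exact h2

/-- Integrating the fundamental theorem of calculus along arcs gives the integration by parts
formula. -/
theorem isDivergence_planDerivation [IsFiniteMeasure m] (hd : IsEMTSpace d)
    (hπ : IsDynamicPlan d π) (hν : arcLengthMeasure π ≪ m)
    (h0 : π.map (evalAt d 0) ≪ m) (h1 : π.map (evalAt d 1) ≪ m) :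
    (planDerivation hd hπ hν).IsDivergence fun x =>
      density (π.map (evalAt d 0)) m x - density (π.map (evalAt d 1)) m x := by
  have := hπ.finite
  have hbdd : ∀ f : LipB d, ∀ x, |(f : X →ᵇ ℝ) x| ≤ ‖(f : X →ᵇ ℝ)‖ := fun f x =>
    (f : X →ᵇ ℝ).norm_coe_le_norm x
  have hfm : ∀ f : LipB d, Measurable (f : X →ᵇ ℝ) := fun f =>
    (f : X →ᵇ ℝ).continuous.measurable
  have hend : ∀ t : I, π.map (evalAt d t) ≪ m → ∀ f : LipB d,
      ∫ x, density (π.map (evalAt d t)) m x * (f : X →ᵇ ℝ) x ∂m =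
        ∫ a : RectArc d, (f : X →ᵇ ℝ) (a.param t) ∂π := fun t ht f => by
    unfold density
    rw [integral_toReal_rnDeriv_mul ht,
      integral_map (hπ.aemeasurable_evalAt hd t) (hfm f).aestronglyMeasurable]
    rfl
  have hint : ∀ (t : I) (f : LipB d),
      Integrable (fun a : RectArc d => (f : X →ᵇ ℝ) (a.param t)) π :=
    fun t f => Integrable.of_bound
      ((hfm f).comp_aemeasurable (hπ.aemeasurable_evalAt hd t)).aestronglyMeasurable
      ‖(f : X →ᵇ ℝ)‖ (Eventually.of_forall fun a => hbdd f _)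
  refine ⟨fun f => (hπ.integrable_planDer hd hν f).congr (planDerivation_apply hd hπ hν f).symm,
    Measure.integrable_toReal_rnDeriv.sub Measure.integrable_toReal_rnDeriv, fun f => ?_⟩
  have hb : ∫ x, planDer d m π (f : X →ᵇ ℝ) x ∂m =
      ∫ p, arcDeriv d (f : X →ᵇ ℝ) p ∂planHat π := by
    simpa using hπ.integral_planDer_mul hd hν f (measurable_const (a := (1 : ℝ))) (C := 1)
      (fun _ => by simp)
  have hFTC : ∫ p, arcDeriv d (f : X →ᵇ ℝ) p ∂planHat π =
      ∫ a : RectArc d, ((f : X →ᵇ ℝ) (a.param 1) - (f : X →ᵇ ℝ) (a.param 0)) ∂π := by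
    have hi := hπ.integrable_arcDeriv hd f
    unfold planHat at hi ⊢
    rw [integral_prod _ hi]
    exact integral_congr_ae (Eventually.of_forall fun a => hd.integral_arcDeriv f a)
  have hsplit : ∫ x, (f : X →ᵇ ℝ) x * (density (π.map (evalAt d 0)) m x -
      density (π.map (evalAt d 1)) m x) ∂m = ∫ x, (density (π.map (evalAt d 0)) m x *
        (f : X →ᵇ ℝ) x - density (π.map (evalAt d 1)) m x * (f : X →ᵇ ℝ) x) ∂m :=
    integral_congr_ae (Eventually.of_forall fun x => by dsimp only; ring)
  rw [integral_congr_ae (planDerivation_apply hd hπ hν f), hb, hFTC,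
    integral_sub (hint 1 f) (hint 0 f), hsplit,
    integral_sub (integrable_density_mul h0 (hfm f) (hbdd f))
      (integrable_density_mul h1 (hfm f) (hbdd f)), hend 0 h0 f, hend 1 h1 f, neg_sub]

end PlanDerivation

end EMTM

theorem proposition5p8 {X : Type*} [TopologicalSpace X] [MeasurableSpace X] [BorelSpace X]
    (d : EMTM.ExtDist X) (hd : EMTM.IsEMTSpace d)
    (m : Measure X) (hm : IsFiniteMeasure m) (hm' : m.InnerRegular)
    (q : ℝ≥0∞) (hq : 1 < q) (hq' : q < ∞)
    (π : Measure (EMTM.RectArc d)) (hπ : EMTM.IsTestPlan d m q π) :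
    -- the evaluation map and the functions `D_f` are measurable, the push-forwards are absolutely
    -- continuous, and `b_π(f)` is in `L^q(m)`
    AEMeasurable (EMTM.evalMap d) (EMTM.planHat π) ∧
    (∀ f : EMTM.LipB d,
      AEMeasurable (EMTM.arcDeriv d (f : X →ᵇ ℝ)) (EMTM.planHat π) ∧
      EMTM.pushPos d π (f : X →ᵇ ℝ) ≪ m ∧ EMTM.pushNeg d π (f : X →ᵇ ℝ) ≪ m ∧
      MemLp (EMTM.planDer d m π (f : X →ᵇ ℝ)) q m) ∧
    -- `b_π` is a derivation in `Der^q_q`, with the stated norm bound and divergence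
    ∃ b : EMTM.LipDerivation d m,
      (∀ f : EMTM.LipB d, b.toFun f =ᵐ[m] EMTM.planDer d m π (f : X →ᵇ ℝ)) ∧
      b.MemDer q q ∧
      (∃ g : X →ₘ[m] ℝ, b.IsPointwiseNorm g ∧
        ∀ μ : Measure X, EMTM.IsBarycenter d π μ → ∀ᵐ x ∂m, g x ≤ EMTM.density μ m x) ∧
      b.IsDivergence (fun x =>
        EMTM.density (π.map (EMTM.evalAt d 0)) m x
          - EMTM.density (π.map (EMTM.evalAt d 1)) m x) := by
  have hdyn : EMTM.IsDynamicPlan d π := hπ.toIsDynamicPlan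
  obtain ⟨μ₀, hμ₀, hac, hLq⟩ := hπ.barycenter
  obtain rfl := hμ₀.eq_arcLengthMeasure hd hdyn
  refine ⟨hdyn.aemeasurable_evalMap hd, fun f => ⟨hdyn.aemeasurable_arcDeriv hd f,
    hdyn.pushPos_absolutelyContinuous hd hac f, hdyn.pushNeg_absolutelyContinuous hd hac f,
    hdyn.memLp_planDer hd hac hLq f⟩, EMTM.planDerivation hd hdyn hac,
    EMTM.planDerivation_apply hd hdyn hac, ?_, ?_, ?_⟩
  · exact ⟨⟨_, EMTM.mk_density_mem_bounds hd hdyn hac, hLq.ae_eq (AEEqFun.coeFn_mk _ _).symm⟩, _,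
      EMTM.isDivergence_planDerivation hd hdyn hac hπ.initial_ac hπ.final_ac,
      hπ.initial_memLp.sub hπ.final_memLp⟩
  · have hmem := EMTM.mk_density_mem_bounds hd hdyn hac
    obtain ⟨g, hg⟩ := EMTM.exists_isGLB_of_inf_mem (fun h hh => hh.1)
      (fun _ hg _ hh => EMTM.LipDerivation.inf_mem_bounds _ hg hh) hmem
      ((hLq.integrable hq.le).congr (AEEqFun.coeFn_mk _ _).symm)
    refine ⟨g, hg, fun μ hμ => ?_⟩
    rw [hμ.eq_arcLengthMeasure hd hdyn]
    filter_upwards [AEEqFun.coeFn_le.2 (hg.1 hmem), AEEqFun.coeFn_mk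
      (EMTM.density (EMTM.arcLengthMeasure π) m)
      (EMTM.measurable_density _ _).aestronglyMeasurable] with x h1 h2
    exact h1.trans_eq h2
  · exact EMTM.isDivergence_planDerivation hd hdyn hac hπ.initial_ac hπ.final_ac
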